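/- **Setting.** Let $\mathbb D$ be the open unit disc and let $H^2_{\mathbb D^2}$ be the Hardy space of the bidisc, i.e. the Hilbert space of functions $f(z_1,z_2)=\sum_{m,n\ge 0}a_{m,n}z_1^mz_2^n$ on $\mathbb D^2$ with $\|f\|^2=\sum|a_{m,n}|^2<\infty$. Let $M_{z_1},M_{z_2}$ be multiplication by the coordinate functions and let $U$ be the unitary on $H^2_{\mathbb D^2}$ given on the orthonormal basis of monomials by $$U(z_1^{m_1}z_2^{m_2})=\begin{cases} z_1^{m_1+2}z_2^{m_2} & m_1\ge m_2,\\ z_1^{m_1+1}z_2^{m_2-1} & m_1+1=m_2,\\ z_1^{m_1}z_2^{m_2-2} & m_1+2\le m_2.\end{cases}$$ Put $\tau_1=U^*M_{z_1}$ and $\tau_2=M_{z_2}U$ (the fundamental isometric pair with negative defect). For commuting isometries $V_1,V_2$ on a Hilbert space the defect operator is $C(V_1,V_2)=I-V_1V_1^*-V_2V_2^*+V_1V_2V_2^*V_1^*$. For commuting bounded operators $T_1,T_2$ on $\mathcal H$, the Koszul complex $K(T_1,T_2)$ is $$0\xrightarrow{\delta_0}\mathcal H\xrightarrow{\delta_1}\mathcal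 H\oplus\mathcal H\xrightarrow{\delta_2}\mathcal H\xrightarrow{\delta_3}0,\qquad \delta_1h=(T_1h,T_2h),\quad \delta_2(h_1,h_2)=T_1h_2-T_2h_1;$$ it is exact at stage $n$ if $\operatorname{ran}\delta_{n-1}=\ker\delta_n$, and the Taylor joint spectrum $\sigma(T_1,T_2)$ is the set of $(\lambda_1,\lambda_2)\in\mathbb C^2$ for which $K(T_1-\lambda_1I,T_2-\lambda_2I)$ is not exact at some stage $n\in\{1,2,3\}$. **Theorem.** Let $(V_1,V_2)$ be a pair of commuting isometries on a complex Hilbert space $\mathcal H$ such that $C(V_1,V_2)\le 0$ and $C(V_1,V_2)\ne 0$, and let $V=V_1V_2$. Then there are a closed subspace $\mathcal L$ with $\{0\}\ne\mathcal L\subsetneq\ker V^*$, whose Hilbert space dimension equals that of the range of $C(V_1,V_2)$, a closed subspace $\mathcal H_0\subseteq\mathcal H$ reducing both $V_1$ and $V_2$, and a unitary $\Phi:H^2_{\mathbb D^2}\otimes\mathcal L\to\mathcal H_0$ (Hilbert space tensor product) such that $$V_i\,\Phi=\Phi\,(\tau_i\otimes I_{\mathcal L})\quad(i=1,2)\qquad\text{and}\qquad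 C\big(V_1|_{\mathcal H_0^\perp},V_2|_{\mathcal H_0^\perp}\big)=0 .$$ That is, up to unitary equivalence $\mathcal H=(H^2_{\mathbb D^2}\otimes\mathcal L)\oplus\mathcal H_0^\perp$ and $V_i=(\tau_i\otimes I_{\mathcal L})\oplus V_i|_{\mathcal H_0^\perp}$. Moreover, $$\sigma(V_1,V_2)=\overline{\mathbb D}\times\overline{\mathbb D},$$ and for every $(\lambda_1,\lambda_2)\in\mathbb D^2$ the Koszul complex $K(V_1-\lambda_1I,V_2-\lambda_2I)$ is not exact at stage 2. -/

import Mathlib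

open scoped Complex.UnitDisc TensorProduct InnerProductSpace

noncomputable section

namespace NegDefect

/-! ### The Hardy space of the bidisc -/

/-- Square summable double sequences `(a_{m,n})`. -/
abbrev CoeffSpace : Type := lp (fun _ : ℕ × ℕ => ℂ) 2

/-- The monomial `z₁^m z₂^n`, as a function on the open bidisc. -/
def monomialFun (k : ℕ × ℕ) (z : 𝔻 × 𝔻) : ℂ := (z.1 : ℂ) ^ k.1 * (z.2 : ℂ) ^ k.2

lemma summable_norm_monomialFun (z : 𝔻 × 𝔻) : Summable fun k => ‖monomialFun k z‖ := by
  have h1 := summable_geometric_of_lt_one (norm_nonneg (z.1 : ℂ)) z.1.norm_lt_one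
  have h2 := summable_geometric_of_lt_one (norm_nonneg (z.2 : ℂ)) z.2.norm_lt_one
  simpa [monomialFun] using h1.mul_of_nonneg h2 (fun _ => by positivity) (fun _ => by positivity)

lemma summable_series (a : CoeffSpace) (z : 𝔻 × 𝔻) :
    Summable fun k => a k * monomialFun k z := by
  refine Summable.of_norm_bounded ((summable_norm_monomialFun z).mul_left ‖a‖) fun k => ?_
  rw [norm_mul]
  gcongr
  exact lp.norm_apply_le_norm (by norm_num) a k

/-- The function `(z₁, z₂) ↦ ∑ a_{m,n} z₁^m z₂^n` on the open bidisc. -/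
def seriesMap : CoeffSpace →ₗ[ℂ] (𝔻 × 𝔻 → ℂ) where
  toFun a z := ∑' k, a k * monomialFun k z
  map_add' a b := by
    funext z
    simp only [lp.coeFn_add, Pi.add_apply, add_mul]
    exact (summable_series a z).tsum_add (summable_series b z)
  map_smul' c a := by
    funext z
    simp only [lp.coeFn_smul, Pi.smul_apply, smul_eq_mul, mul_assoc, RingHom.id_apply]
    exact tsum_mul_left

lemma hasSum_seriesMap (a : CoeffSpace) (z : 𝔻 × 𝔻) :
    HasSum (fun k => a k * monomialFun k z) (seriesMap a z) := (summable_series a z).hasSum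

lemma coeff_eq_zero {c : ℕ → ℂ} (h : ∀ z : 𝔻, HasSum (fun n => c n * (z : ℂ) ^ n) 0) (n : ℕ) :
    c n = 0 := by
  have hp : HasFPowerSeriesAt (0 : ℂ → ℂ) (FormalMultilinearSeries.ofScalars ℂ c) 0 := by
    rw [hasFPowerSeriesAt_iff]
    filter_upwards [Metric.ball_mem_nhds (0 : ℂ) one_pos] with z hz
    have hz' : ‖z‖ < 1 := by simpa using hz
    simpa [FormalMultilinearSeries.coeff_ofScalars, mul_comm] using h (Complex.UnitDisc.mk z hz')
  have h0 : FormalMultilinearSeries.ofScalars ℂ c = 0 := hp.eq_zero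
  rw [← FormalMultilinearSeries.coeff_ofScalars (𝕜 := ℂ) (p := c) (n := n), h0]
  rfl

lemma seriesMap_injective : Function.Injective seriesMap := by
  rw [← LinearMap.ker_eq_bot, LinearMap.ker_eq_bot']
  intro a ha
  have h2 : ∀ (m : ℕ) (w : 𝔻), HasSum (fun n => a (m, n) * (w : ℂ) ^ n) 0 := by
    intro m w
    have hs : ∀ m, Summable fun n => a (m, n) * (w : ℂ) ^ n := by
      intro m
      refine Summable.of_norm_bounded ((summable_geometric_of_lt_one (norm_nonneg (w : ℂ))
        w.norm_lt_one).mul_left ‖a‖) fun n => ?_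
      rw [norm_mul, norm_pow]
      gcongr
      exact lp.norm_apply_le_norm (by norm_num) a (m, n)
    have key := coeff_eq_zero (c := fun m => ∑' n, a (m, n) * (w : ℂ) ^ n) (fun z => ?_) m
    · have := (hs m).hasSum
      rwa [key] at this
    · have h := hasSum_seriesMap a (z, w)
      rw [ha] at h
      refine h.prod_fiberwise (g := fun m => (∑' n, a (m, n) * (w : ℂ) ^ n) * (z : ℂ) ^ m)
        fun m => ?_
      simpa [monomialFun, mul_assoc, mul_comm, mul_left_comm] using
        (hs m).hasSum.mul_right ((z : ℂ) ^ m)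
  ext ⟨m, n⟩
  exact coeff_eq_zero (h2 m) n

/-- The Hardy space `H²(𝔻²)`: the functions on the open bidisc of the form
`∑ a_{m,n} z₁^m z₂^n` with `∑ |a_{m,n}|² < ∞`. -/
def HardyBidisc : Type := ↥(LinearMap.range seriesMap)

namespace HardyBidisc

instance : AddCommGroup HardyBidisc := inferInstanceAs (AddCommGroup ↥(LinearMap.range seriesMap))

instance : Module ℂ HardyBidisc := inferInstanceAs (Module ℂ ↥(LinearMap.range seriesMap))

instance : CoeFun HardyBidisc fun _ => 𝔻 × 𝔻 → ℂ := ⟨fun f => f.1⟩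

/-- The Taylor coefficients of an element of the Hardy space. -/
def coeffEquiv : HardyBidisc ≃ₗ[ℂ] CoeffSpace :=
  (LinearEquiv.ofInjective seriesMap seriesMap_injective).symm

/-- `‖f‖² = ∑ |a_{m,n}|²`. -/
instance : NormedAddCommGroup HardyBidisc :=
  NormedAddCommGroup.induced HardyBidisc CoeffSpace coeffEquiv coeffEquiv.injective

/-- The inner product is that of the Taylor coefficients. -/
instance : InnerProductSpace ℂ HardyBidisc where
  toNormedSpace := NormedSpace.induced ℂ HardyBidisc CoeffSpace coeffEquiv
  inner f g := ⟪coeffEquiv f, coeffEquiv g⟫_ℂ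
  norm_sq_eq_re_inner f := norm_sq_eq_re_inner (𝕜 := ℂ) (coeffEquiv f)
  conj_inner_symm f g := inner_conj_symm (coeffEquiv f) (coeffEquiv g)
  add_left f g h := by rw [map_add, inner_add_left]
  smul_left f g c := by rw [map_smul, inner_smul_left]

/-- `f ↦ (a_{m,n})` is unitary. -/
def coeffIso : HardyBidisc ≃ₗᵢ[ℂ] CoeffSpace where
  toLinearEquiv := coeffEquiv
  norm_map' _ := rfl

instance : CompleteSpace HardyBidisc :=
  coeffIso.toIsometryEquiv.completeSpace

lemma seriesMap_coeffIso (f : HardyBidisc) : seriesMap (coeffIso f) = f.1 :=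
  congrArg Subtype.val (coeffEquiv.symm_apply_apply f)

lemma hasSum_coeff (f : HardyBidisc) (z : 𝔻 × 𝔻) :
    HasSum (fun k => coeffIso f k * monomialFun k z) (f z) := by
  have h := hasSum_seriesMap (coeffIso f) z
  rwa [seriesMap_coeffIso] at h

/-- The orthonormal basis `z₁^m z₂^n` of the Hardy space. -/
def monomialBasis : HilbertBasis (ℕ × ℕ) ℂ HardyBidisc := HilbertBasis.ofRepr coeffIso

lemma monomialBasis_apply (k : ℕ × ℕ) (z : 𝔻 × 𝔻) : monomialBasis k z = monomialFun k z := by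
  classical
  have h := hasSum_coeff (monomialBasis k) z
  have h1 : coeffIso (monomialBasis k) = lp.single 2 k 1 := monomialBasis.repr_self k
  rw [h1] at h
  refine h.unique ?_
  convert hasSum_ite_eq k (monomialFun k z) using 2 with j
  by_cases hj : j = k
  · subst hj; simp
  · simp [hj]

/-! ### Multiplication by the coordinate functions -/

lemma memLp_extend {σ : ℕ × ℕ → ℕ × ℕ} (hσ : Function.Injective σ) (a : CoeffSpace) :
    Memℓp (E := fun _ : ℕ × ℕ => ℂ) (Function.extend σ a 0) 2 := by
  have h := (lp.memℓp a).summable (by norm_num)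
  refine memℓp_gen ?_
  rw [← hσ.summable_iff]
  · simpa [Function.comp_def, hσ.extend_apply] using h
  · intro k hk
    rw [Function.extend_apply' _ _ _ hk]
    simp

/-- The isometry of `ℓ²(ℕ²)` that moves the `k`-th coefficient to the place `σ k`. -/
def pushCoeff (σ : ℕ × ℕ → ℕ × ℕ) (hσ : Function.Injective σ) : CoeffSpace →ₗᵢ[ℂ] CoeffSpace where
  toFun a := ⟨Function.extend σ a 0, memLp_extend hσ a⟩
  map_add' a b := by
    ext k
    change Function.extend σ (⇑a + ⇑b) 0 k = Function.extend σ a 0 k + Function.extend σ b 0 k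
    by_cases hk : ∃ j, σ j = k
    · obtain ⟨j, rfl⟩ := hk
      simp only [hσ.extend_apply, Pi.add_apply]
    · simp only [Function.extend_apply' _ _ _ hk, Pi.zero_apply, add_zero]
  map_smul' c a := by
    ext k
    change Function.extend σ (c • ⇑a) 0 k = c * Function.extend σ a 0 k
    by_cases hk : ∃ j, σ j = k
    · obtain ⟨j, rfl⟩ := hk
      simp only [hσ.extend_apply, Pi.smul_apply, smul_eq_mul]
    · simp only [Function.extend_apply' _ _ _ hk, Pi.zero_apply, mul_zero]
  norm_map' a := by
    have h2 : (0 : ℝ) < (2 : ENNReal).toReal := by norm_num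
    rw [lp.norm_eq_tsum_rpow h2, lp.norm_eq_tsum_rpow h2]
    congr 1
    change ∑' k, ‖Function.extend σ a 0 k‖ ^ (2 : ENNReal).toReal = _
    rw [← hσ.tsum_eq]
    · simp only [hσ.extend_apply]
    · intro k hk
      by_contra hk'
      apply hk
      change ‖Function.extend σ a 0 k‖ ^ (2 : ENNReal).toReal = 0
      rw [Function.extend_apply' _ _ _ hk']
      simp

lemma pushCoeff_apply {σ : ℕ × ℕ → ℕ × ℕ} (hσ : Function.Injective σ) (a : CoeffSpace)
    (k : ℕ × ℕ) : pushCoeff σ hσ a (σ k) = a k := hσ.extend_apply _ _ _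

lemma seriesMap_pushCoeff {σ : ℕ × ℕ → ℕ × ℕ} (hσ : Function.Injective σ) (g : 𝔻 × 𝔻 → ℂ)
    (hg : ∀ k z, monomialFun (σ k) z = g z * monomialFun k z) (a : CoeffSpace) (z : 𝔻 × 𝔻) :
    seriesMap (pushCoeff σ hσ a) z = g z * seriesMap a z := by
  have h := hasSum_seriesMap (pushCoeff σ hσ a) z
  rw [← hσ.hasSum_iff] at h
  · refine h.unique ?_
    refine ((hasSum_seriesMap a z).mul_left (g z)).congr_fun ?_
    intro k
    rw [Function.comp_apply, pushCoeff_apply, hg]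
    ring
  · intro k hk
    have : pushCoeff σ hσ a k = 0 := Function.extend_apply' _ _ _ hk
    simp [this]

lemma mul_mem {σ : ℕ × ℕ → ℕ × ℕ} (hσ : Function.Injective σ) (g : 𝔻 × 𝔻 → ℂ)
    (hg : ∀ k z, monomialFun (σ k) z = g z * monomialFun k z) (f : HardyBidisc) :
    (fun z => g z * f z) ∈ LinearMap.range seriesMap := by
  refine ⟨pushCoeff σ hσ (coeffIso f), ?_⟩
  funext z
  rw [seriesMap_pushCoeff hσ g hg, seriesMap_coeffIso]

/-- The operator `f ↦ g f` for a function `g` that maps monomials injectively to monomials. -/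
def mulIsometry {σ : ℕ × ℕ → ℕ × ℕ} (hσ : Function.Injective σ) (g : 𝔻 × 𝔻 → ℂ)
    (hg : ∀ k z, monomialFun (σ k) z = g z * monomialFun k z) : HardyBidisc →ₗᵢ[ℂ] HardyBidisc where
  toFun f := ⟨fun z => g z * f z, mul_mem hσ g hg f⟩
  map_add' f₁ f₂ := Subtype.ext (funext fun z => mul_add (g z) (f₁ z) (f₂ z))
  map_smul' c f := Subtype.ext (funext fun z => mul_left_comm (g z) c (f z))
  norm_map' f := by
    have h : (⟨fun z => g z * f z, mul_mem hσ g hg f⟩ : HardyBidisc) =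
        coeffIso.symm (pushCoeff σ hσ (coeffIso f)) := by
      refine Subtype.ext (funext fun z => ?_)
      refine Eq.trans ?_ (seriesMap_pushCoeff hσ g hg (coeffIso f) z).symm
      rw [seriesMap_coeffIso]
    refine (congrArg (fun x : HardyBidisc => ‖x‖) h).trans ?_
    simp

/-- Multiplication by `z₁`. -/
def mulZ1 : HardyBidisc →ₗᵢ[ℂ] HardyBidisc :=
  mulIsometry (σ := fun k => (k.1 + 1, k.2)) (fun j k h => by simpa [Prod.ext_iff] using h)
    (fun z => (z.1 : ℂ)) (fun k z => by simp only [monomialFun]; ring)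

/-- Multiplication by `z₂`. -/
def mulZ2 : HardyBidisc →ₗᵢ[ℂ] HardyBidisc :=
  mulIsometry (σ := fun k => (k.1, k.2 + 1)) (fun j k h => by simpa [Prod.ext_iff] using h)
    (fun z => (z.2 : ℂ)) (fun k z => by simp only [monomialFun]; ring)

lemma mulZ1_apply (f : HardyBidisc) (z : 𝔻 × 𝔻) : mulZ1 f z = (z.1 : ℂ) * f z := rfl

lemma mulZ2_apply (f : HardyBidisc) (z : 𝔻 × 𝔻) : mulZ2 f z = (z.2 : ℂ) * f z := rfl

/-! ### The fundamental isometric pair with negative defect -/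

/-- The permutation of the exponents that defines the unitary `U`. -/
def exponentPerm : Equiv.Perm (ℕ × ℕ) where
  toFun k :=
    if k.2 ≤ k.1 then (k.1 + 2, k.2)
    else if k.1 + 1 = k.2 then (k.1 + 1, k.2 - 1)
    else (k.1, k.2 - 2)
  invFun k :=
    if k.2 + 2 ≤ k.1 then (k.1 - 2, k.2)
    else if k.2 + 1 = k.1 then (k.1 - 1, k.2 + 1)
    else (k.1, k.2 + 2)
  left_inv := by
    rintro ⟨m, n⟩
    ext <;> dsimp only <;> split_ifs <;> dsimp only at * <;> omega
  right_inv := by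
    rintro ⟨m, n⟩
    ext <;> dsimp only <;> split_ifs <;> dsimp only at * <;> omega

/-- The unitary `U` of `H²(𝔻²)` that permutes the monomials by `exponentPerm`. -/
def unitaryU : HardyBidisc ≃ₗᵢ[ℂ] HardyBidisc :=
  coeffIso.trans ((LinearIsometryEquiv.ofSurjective (pushCoeff exponentPerm exponentPerm.injective)
    (fun a => ⟨pushCoeff exponentPerm.symm exponentPerm.symm.injective a, by
      ext k
      obtain ⟨j, rfl⟩ := exponentPerm.surjective k
      rw [pushCoeff_apply]
      conv_lhs => rw [← exponentPerm.symm_apply_apply j]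
      rw [pushCoeff_apply]⟩)).trans coeffIso.symm)

lemma unitaryU_monomial (k : ℕ × ℕ) :
    unitaryU (monomialBasis k) = monomialBasis (exponentPerm k) := by
  classical
  apply coeffIso.injective
  have h1 : ∀ j, coeffIso (monomialBasis j) = lp.single 2 j 1 := monomialBasis.repr_self
  have h2 : coeffIso (unitaryU (monomialBasis k)) =
      pushCoeff exponentPerm exponentPerm.injective (coeffIso (monomialBasis k)) := by
    exact coeffIso.apply_symm_apply _
  rw [h2, h1, h1]
  ext j
  obtain ⟨i, rfl⟩ := exponentPerm.surjective j
  rw [pushCoeff_apply]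
  simp [Pi.single_apply]

/-- `τ₁ = U* M_{z₁}`. -/
def tau1 : HardyBidisc →ₗᵢ[ℂ] HardyBidisc := unitaryU.symm.toLinearIsometry.comp mulZ1

/-- `τ₂ = M_{z₂} U`. -/
def tau2 : HardyBidisc →ₗᵢ[ℂ] HardyBidisc := mulZ2.comp unitaryU.toLinearIsometry

end HardyBidisc

/-! ### Hilbert tensor products, defect operators and Hilbert dimension -/

universe u v

/-- The Hilbert space tensor product: the completion of the algebraic tensor product. -/
abbrev HilbertTensor (E : Type u) (F : Type v) [NormedAddCommGroup E] [InnerProductSpace ℂ E]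
    [NormedAddCommGroup F] [InnerProductSpace ℂ F] : Type (max u v) :=
  UniformSpace.Completion (E ⊗[ℂ] F)

/-- The operator `T ⊗ I_F` on the Hilbert space tensor product, for an isometry `T`. -/
def tensorId {E : Type u} [NormedAddCommGroup E] [InnerProductSpace ℂ E] (T : E →ₗᵢ[ℂ] E)
    (F : Type v) [NormedAddCommGroup F] [InnerProductSpace ℂ F] :
    HilbertTensor E F →L[ℂ] HilbertTensor E F :=
  (T.rTensor F).toContinuousLinearMap.completion

/-- The defect operator `C(V₁,V₂) = I - V₁V₁* - V₂V₂* + V₁V₂V₂*V₁*`. -/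
def defect {H : Type u} [NormedAddCommGroup H] [InnerProductSpace ℂ H] [CompleteSpace H]
    (V₁ V₂ : H →L[ℂ] H) : H →L[ℂ] H :=
  1 - V₁ * star V₁ - V₂ * star V₂ + V₁ * V₂ * star V₂ * star V₁

/-- Equality of Hilbert space dimensions: there are (Hilbert space) orthonormal bases with the
same index set. -/
def SameHilbertDim (E F : Type u) [NormedAddCommGroup E] [InnerProductSpace ℂ E]
    [NormedAddCommGroup F] [InnerProductSpace ℂ F] : Prop :=
  ∃ ι : Type u, Nonempty (HilbertBasis ι ℂ E) ∧ Nonempty (HilbertBasis ι ℂ F)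

/-! ### The Koszul complex and the Taylor joint spectrum of a pair -/

section Koszul

variable {H : Type u} [NormedAddCommGroup H] [InnerProductSpace ℂ H]

/-- `δ₀ : 0 → H`. -/
def koszul0 (H : Type u) [NormedAddCommGroup H] [InnerProductSpace ℂ H] : PUnit.{1} →ₗ[ℂ] H := 0

/-- `δ₁ h = (T₁ h, T₂ h)`. -/
def koszul1 (T₁ T₂ : H →L[ℂ] H) : H →ₗ[ℂ] H × H := (T₁ : H →ₗ[ℂ] H).prod (T₂ : H →ₗ[ℂ] H)

/-- `δ₂ (h₁, h₂) = T₁ h₂ - T₂ h₁`. -/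
def koszul2 (T₁ T₂ : H →L[ℂ] H) : H × H →ₗ[ℂ] H :=
  (T₁ : H →ₗ[ℂ] H) ∘ₗ LinearMap.snd ℂ H H - (T₂ : H →ₗ[ℂ] H) ∘ₗ LinearMap.fst ℂ H H

/-- `δ₃ : H → 0`. -/
def koszul3 (H : Type u) [NormedAddCommGroup H] [InnerProductSpace ℂ H] : H →ₗ[ℂ] PUnit.{1} := 0

/-- Exactness of the Koszul complex of `(T₁, T₂)` at stage 1. -/
def KoszulExact1 (T₁ T₂ : H →L[ℂ] H) : Prop :=
  LinearMap.range (koszul0 H) = LinearMap.ker (koszul1 T₁ T₂)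

/-- Exactness of the Koszul complex of `(T₁, T₂)` at stage 2. -/
def KoszulExact2 (T₁ T₂ : H →L[ℂ] H) : Prop :=
  LinearMap.range (koszul1 T₁ T₂) = LinearMap.ker (koszul2 T₁ T₂)

/-- Exactness of the Koszul complex of `(T₁, T₂)` at stage 3. -/
def KoszulExact3 (T₁ T₂ : H →L[ℂ] H) : Prop :=
  LinearMap.range (koszul2 T₁ T₂) = LinearMap.ker (koszul3 H)

/-- A pair is non-singular if its Koszul complex is exact. -/
def NonSingular (T₁ T₂ : H →L[ℂ] H) : Prop :=
  KoszulExact1 T₁ T₂ ∧ KoszulExact2 T₁ T₂ ∧ KoszulExact3 T₁ T₂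

/-- The Taylor joint spectrum of a (commuting) pair of bounded operators. -/
def jointSpectrum (T₁ T₂ : H →L[ℂ] H) : Set (ℂ × ℂ) :=
  {l | ¬ NonSingular (T₁ - l.1 • (1 : H →L[ℂ] H)) (T₂ - l.2 • (1 : H →L[ℂ] H))}

end Koszul

end NegDefect

end

/-! Write `A`, `B` for the two isometries, `V = A B` and `C` for the defect. If `A* x = 0`, then `C
≤ 0` gives `‖x‖ ≤ ‖B* x‖`, hence `x = B B* x`. So `ker A* ⊆ ran B`, and symmetrically `ker B* ⊆ ran
A`. It follows that `C` vanishes on `ker A*`, on `ker B*` and on `ran V`. Being self-adjoint, `C`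
has its range in `ran A ∩ ran B ∩ ker V*`, where it acts as `-1`. Thus `-C` is the projection onto
this intersection, which serves as `L`.

For `x` in `L`, the vectors `A*^d x` and `B*^d x` lie in `ker V*`, and `A`, `B` undo their own
adjoints along these two chains. Pushing the chains forward by powers of `V` and letting `x` run
through an orthonormal basis of `L` gives an orthonormal family indexed by monomials and basis
vectors (`inner_modelShift`). On it `A` and `B` act by the index maps of `τ₁` and `τ₂`. Its closed
span reduces the pair and contains `L`, so no defect is left on the complement.

For the spectrum, Möbius transforms in each variable turn `C` into a nonzero positive multiple of `K
C K*` with `K` invertible. This moves a point of the open bidisc to the origin, where a nonzero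
defect vector obstructs exactness at stage 2. The boundary is reached by continuity, since near a
nonsingular point stage 2 stays exact. Outside the closed bidisc one of the shifted operators is
invertible. -/

noncomputable section

namespace NegDefect

/-! ### Geometry of a negative defect -/

section NegativePair

variable {H : Type*} [NormedAddCommGroup H] [InnerProductSpace ℂ H] [CompleteSpace H]

/-- A commuting pair of isometries with negative semidefinite defect operator. -/
structure IsNegPair (A B : H →L[ℂ] H) : Prop where
  star_mul_left : star A * A = 1
  star_mul_right : star B * B = 1
  comm : A * B = B * A
  defect_nonpos : defect A B ≤ 0

/-- The common part of the ranges of `A` and `B` that is killed by `(AB)*`. -/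
structure IsDefectVector (A B : H →L[ℂ] H) (x : H) : Prop where
  left : A (star A x) = x
  right : B (star B x) = x
  star_left_star_right : star A (star B x) = 0

lemma defect_apply (A B : H →L[ℂ] H) (x : H) :
    defect A B x = x - A (star A x) - B (star B x) + A (B (star B (star A x))) := rfl

lemma defect_comm {A B : H →L[ℂ] H} (h : A * B = B * A) : defect A B = defect B A := by
  have h' : star B * star A = star A * star B := by rw [← star_mul, h, star_mul]
  simp only [defect]
  rw [mul_assoc (A * B), h', h]
  noncomm_ring

lemma isSelfAdjoint_defect {A B : H →L[ℂ] H} : IsSelfAdjoint (defect A B) := by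
  simp only [IsSelfAdjoint, defect, star_add, star_sub, star_mul, star_star, star_one, mul_assoc]

lemma inner_star_right (A : H →L[ℂ] H) (x y : H) : ⟪x, star A y⟫_ℂ = ⟪A x, y⟫_ℂ :=
  ContinuousLinearMap.adjoint_inner_right A x y

lemma inner_star_left (A : H →L[ℂ] H) (x y : H) : ⟪star A x, y⟫_ℂ = ⟪x, A y⟫_ℂ :=
  ContinuousLinearMap.adjoint_inner_left A y x

namespace IsNegPair

variable {A B : H →L[ℂ] H}

lemma symm (h : IsNegPair A B) : IsNegPair B A :=
  ⟨h.star_mul_right, h.star_mul_left, h.comm.symm, defect_comm h.comm ▸ h.defect_nonpos⟩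

lemma star_apply_left (h : IsNegPair A B) (x : H) : star A (A x) = x :=
  DFunLike.congr_fun h.star_mul_left x

lemma comm_apply (h : IsNegPair A B) (x : H) : A (B x) = B (A x) :=
  DFunLike.congr_fun h.comm x

lemma star_comm_apply (h : IsNegPair A B) (x : H) : star A (star B x) = star B (star A x) := by
  have : star A * star B = star B * star A := by rw [← star_mul, ← h.comm, star_mul]
  exact DFunLike.congr_fun this x

lemma inner_apply_left (h : IsNegPair A B) (x y : H) : ⟪A x, A y⟫_ℂ = ⟪x, y⟫_ℂ := by
  rw [← inner_star_right, h.star_apply_left]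

/-- On `ker A*` the form of `-C` is `‖B* x‖² - ‖x‖²`. Its nonnegativity forces equality in `‖B B* x‖
≤ ‖x‖`, and a projection that preserves the norm of a vector fixes it. -/
lemma right_star_right_of_star_left_eq_zero (h : IsNegPair A B) {x : H} (hx : star A x = 0) :
    B (star B x) = x := by
  have h1 := (ContinuousLinearMap.le_def _ _).1 h.defect_nonpos
  have h2 := h1.re_inner_nonneg_left x
  have h3 : (0 - defect A B) x = B (star B x) - x := by
    rw [sub_apply, defect_apply, hx]
    simp
  rw [h3, inner_sub_left] at h2
  have h4 : ⟪B (star B x), x⟫_ℂ = ⟪star B x, star B x⟫_ℂ := by rw [inner_star_right]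
  have h5 : ⟪x, B (star B x)⟫_ℂ = ⟪star B x, star B x⟫_ℂ := by rw [inner_star_left]
  have h6 : ‖B (star B x) - x‖ ^ 2 ≤ 0 := by
    rw [@norm_sub_sq ℂ, ← inner_self_eq_norm_sq (𝕜 := ℂ), h.symm.inner_apply_left, h4,
      ← inner_self_eq_norm_sq (𝕜 := ℂ) x]
    rw [h4, map_sub] at h2
    linarith
  rw [← sub_eq_zero, ← norm_eq_zero]
  exact pow_eq_zero_iff two_ne_zero |>.1 (le_antisymm h6 (sq_nonneg _))

lemma defect_eq_zero_of_star_left (h : IsNegPair A B) {x : H} (hx : star A x = 0) :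
    defect A B x = 0 := by
  rw [defect_apply, h.right_star_right_of_star_left_eq_zero hx, hx]
  simp

lemma defect_apply_mul (h : IsNegPair A B) (y : H) : defect A B (B (A y)) = 0 := by
  rw [defect_apply, ← h.comm_apply, h.star_apply_left, h.symm.star_apply_left, h.comm_apply,
    h.symm.star_apply_left]
  simp

lemma inner_defect_left (x y : H) : ⟪defect A B x, y⟫_ℂ = ⟪x, defect A B y⟫_ℂ := by
  conv_lhs => rw [← isSelfAdjoint_defect.star_eq]
  rw [inner_star_left]

/-- By self-adjointness these are dual to the vanishing of `C` on `ker A*`, `ker B*` and `ran B A`;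
for instance `y - A A* y` lies in `ker A*`, so `C A A* = C`. -/
lemma isDefectVector_defect (h : IsNegPair A B) (x : H) :
    IsDefectVector A B (defect A B x) := by
  have key : ∀ {A B : H →L[ℂ] H}, IsNegPair A B → ∀ x,
      A (star A (defect A B x)) = defect A B x := by
    intro A B h x
    refine ext_inner_right ℂ fun y => ?_
    rw [← inner_star_right, inner_star_left, inner_defect_left, inner_defect_left,
      ← sub_eq_zero, ← inner_sub_right, ← map_sub, h.defect_eq_zero_of_star_left, inner_zero_right]
    rw [map_sub, h.star_apply_left, sub_self]
  refine ⟨key h x, ?_, ?_⟩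
  · rw [defect_comm h.comm]
    exact key h.symm x
  · refine ext_inner_right ℂ fun y => ?_
    rw [inner_star_left, inner_star_left, inner_defect_left, h.defect_apply_mul]
    simp

end IsNegPair

namespace IsDefectVector

variable {A B : H →L[ℂ] H} {x : H}

lemma defect_eq (h : IsNegPair A B) (hx : IsDefectVector A B x) : defect A B x = -x := by
  rw [defect_apply, hx.left, hx.right, ← h.star_comm_apply, hx.star_left_star_right]
  simp

lemma symm (h : IsNegPair A B) (hx : IsDefectVector A B x) : IsDefectVector B A x :=
  ⟨hx.right, hx.left, h.star_comm_apply x ▸ hx.star_left_star_right⟩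

lemma inner_eq_zero (h : IsNegPair A B) (hx : IsDefectVector A B x) {y : H}
    (hy : star A y = 0) : ⟪x, y⟫_ℂ = 0 := by
  rw [← neg_eq_zero, ← inner_neg_left, ← hx.defect_eq h, IsNegPair.inner_defect_left,
    h.defect_eq_zero_of_star_left hy, inner_zero_right]

end IsDefectVector

lemma IsNegPair.mem_range_defect {A B : H →L[ℂ] H} (h : IsNegPair A B) {x : H} :
    x ∈ LinearMap.range (defect A B).toLinearMap ↔ IsDefectVector A B x := by
  constructor
  · rintro ⟨y, rfl⟩
    exact h.isDefectVector_defect y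
  · intro hx
    exact ⟨-x, by simp [hx.defect_eq h]⟩

/-- The range is the eigenspace of `C` for the eigenvalue `-1`. -/
lemma IsNegPair.isClosed_range_defect {A B : H →L[ℂ] H} (h : IsNegPair A B) :
    IsClosed (LinearMap.range (defect A B).toLinearMap : Set H) := by
  have : (LinearMap.range (defect A B).toLinearMap : Set H) = {x | defect A B x = -x} := by
    ext x
    refine ⟨fun hx => (h.mem_range_defect.1 hx).defect_eq h, fun hx => ⟨-x, ?_⟩⟩
    have hx' : defect A B x = -x := hx
    simp [hx']
  rw [this]
  exact isClosed_eq (defect A B).continuous continuous_neg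

/-- The kernel of `V*` is invariant under `A*`. Were it equal to `ran C`, then for `x` in `ran C`
the vector `A* x` would lie in `ran B` and in `ker B*`, so `A* x = 0` and `x = A A* x = 0`. -/
lemma IsNegPair.range_defect_lt_ker {A B : H →L[ℂ] H} (h : IsNegPair A B)
    (hne : defect A B ≠ 0) :
    LinearMap.range (defect A B).toLinearMap <
      LinearMap.ker (star (A * B) : H →L[ℂ] H).toLinearMap := by
  have hker : ∀ x, x ∈ LinearMap.ker (star (A * B) : H →L[ℂ] H).toLinearMap ↔
      star B (star A x) = 0 := fun x => by simp [star_mul]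
  refine lt_of_le_of_ne (fun x hx => ?_) fun heq => hne ?_
  · rw [hker, ← h.star_comm_apply]
    exact (h.mem_range_defect.1 hx).star_left_star_right
  · ext x
    have hx := h.isDefectVector_defect x
    have hy : IsDefectVector A B (star A (defect A B x)) := by
      rw [← h.mem_range_defect, heq, hker, ← h.star_comm_apply, ← h.star_comm_apply,
        hx.star_left_star_right, map_zero]
    have h0 := hy.right
    rw [← h.star_comm_apply, hx.star_left_star_right, map_zero] at h0
    rw [← hx.left, ← h0]
    simp

end NegativePair

/-! ### Möbius transforms of an isometry -/

section Moebius

variable {H : Type*} [NormedAddCommGroup H] [InnerProductSpace ℂ H] [CompleteSpace H]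

/-- The defect operator, as an iterated difference in the first variable. -/
lemma defect_eq_sub_conj (A B : H →L[ℂ] H) :
    defect A B = (1 - B * star B) - A * (1 - B * star B) * star A := by
  simp only [defect]
  noncomm_ring

lemma ofReal_one_sub_norm_sq (l : ℂ) :
    ((1 - ‖l‖ ^ 2 : ℝ) : ℂ) = 1 - starRingEnd ℂ l * l := by
  push_cast
  rw [Complex.conj_mul']

/-- This is `(1 - l̄V)(1 - l̄V)* - (V - l)(V - l)* = (1 - |l|²)(1 - V V*)`, conjugated by `K = (1 -
l̄V)⁻¹`. -/
lemma one_sub_moebius {V K : H →L[ℂ] H} {l : ℂ} (hK : K * (1 - starRingEnd ℂ l • V) = 1)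
    (hc : Commute K V) :
    1 - ((V - l • 1) * K) * star ((V - l • 1) * K) =
      ((1 - ‖l‖ ^ 2 : ℝ) : ℂ) • (K * (1 - V * star V) * star K) := by
  have hc' : (V - l • 1) * K = K * (V - l • 1) := by
    rw [sub_mul, mul_sub, hc.eq, smul_one_mul, mul_smul_one]
  have h1 : (1 : H →L[ℂ] H) =
      K * ((1 - starRingEnd ℂ l • V) * star (1 - starRingEnd ℂ l • V)) * star K := by
    rw [← mul_assoc, hK, one_mul, ← star_mul, hK, star_one]
  have h2 : (1 - starRingEnd ℂ l • V) * star (1 - starRingEnd ℂ l • V)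
      - (V - l • 1) * star (V - l • 1) = (1 - starRingEnd ℂ l * l) • (1 - V * star V) := by
    simp only [star_sub, star_smul, star_one, sub_mul, mul_sub, one_mul, mul_one, smul_mul_assoc,
      mul_smul_comm, smul_smul, smul_sub, ← starRingEnd_apply, Complex.conj_conj]
    module
  have h3 : K * ((V - l • 1) * star (V - l • 1)) * star K =
      ((V - l • 1) * K) * star ((V - l • 1) * K) := by
    rw [hc', star_mul]
    simp only [mul_assoc]
  rw [ofReal_one_sub_norm_sq, ← smul_mul_assoc, ← mul_smul_comm, ← h2,
    mul_sub K (_ * star (1 - _)), sub_mul _ _ (star K), ← h1, h3]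

lemma star_moebius_mul_moebius {V K : H →L[ℂ] H} {l : ℂ} (hV : star V * V = 1)
    (hK : (1 - starRingEnd ℂ l • V) * K = 1) :
    star ((V - l • 1) * K) * ((V - l • 1) * K) = 1 := by
  have h2 : star (V - l • 1) * (V - l • 1) =
      star (1 - starRingEnd ℂ l • V) * (1 - starRingEnd ℂ l • V) := by
    simp only [star_sub, star_smul, star_one, sub_mul, mul_sub, one_mul, mul_one, smul_mul_assoc,
      mul_smul_comm, smul_smul, smul_sub, ← starRingEnd_apply, Complex.conj_conj, hV]
    module
  calc _ = star K * (star (V - l • 1) * (V - l • 1)) * K := by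
        rw [star_mul]; simp only [mul_assoc]
    _ = star ((1 - starRingEnd ℂ l • V) * K) * ((1 - starRingEnd ℂ l • V) * K) := by
        rw [h2, star_mul]; simp only [mul_assoc]
    _ = 1 := by rw [hK, star_one, one_mul]

lemma norm_le_one_of_star_mul_self {V : H →L[ℂ] H} (hV : star V * V = 1) : ‖V‖ ≤ 1 := by
  refine V.opNorm_le_bound zero_le_one fun x => ?_
  rw [one_mul, (V.norm_map_iff_adjoint_comp_self).2 hV]

lemma exists_inverse_one_sub_smul {V : H →L[ℂ] H} (hV : star V * V = 1) {l : ℂ} (hl : ‖l‖ < 1) :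
    ∃ K : H →L[ℂ] H, K * (1 - starRingEnd ℂ l • V) = 1 ∧ (1 - starRingEnd ℂ l • V) * K = 1 := by
  have : ‖starRingEnd ℂ l • V‖ < 1 := by
    rw [norm_smul, RCLike.norm_conj]
    have := norm_le_one_of_star_mul_self hV
    nlinarith [norm_nonneg l]
  obtain ⟨u, hu⟩ := isUnit_one_sub_of_norm_lt_one this
  exact ⟨(u⁻¹ : (H →L[ℂ] H)ˣ), by rw [← hu, u.inv_mul], by rw [← hu, u.mul_inv]⟩

lemma commute_of_inverse {R : Type*} [Monoid R] {K N T : R} (h1 : K * N = 1) (h2 : N * K = 1)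
    (h : Commute N T) : Commute K T := by
  calc K * T = K * (T * N) * K := by rw [mul_assoc, mul_assoc, h2, mul_one]
    _ = T * K := by rw [← h.eq, ← mul_assoc, h1, one_mul]

/-- A Möbius transform of the second isometry preserves negative defect. -/
lemma IsNegPair.exists_moebius {A B : H →L[ℂ] H} (h : IsNegPair A B) (hne : defect A B ≠ 0)
    {l : ℂ} (hl : ‖l‖ < 1) :
    ∃ K : H →L[ℂ] H, K * (1 - starRingEnd ℂ l • B) = 1 ∧ (1 - starRingEnd ℂ l • B) * K = 1 ∧
      IsNegPair A ((B - l • 1) * K) ∧ defect A ((B - l • 1) * K) ≠ 0 := by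
  obtain ⟨K, hK1, hK2⟩ := exists_inverse_one_sub_smul h.star_mul_right hl
  have hAB : Commute A B := h.comm
  have hKB : Commute K B := commute_of_inverse hK1 hK2
    ((Commute.one_left B).sub_left ((Commute.refl B).smul_left _))
  have hKA : Commute K A := commute_of_inverse hK1 hK2
    ((Commute.one_left A).sub_left (hAB.symm.smul_left _))
  have hpos : (0 : ℝ) < 1 - ‖l‖ ^ 2 := by nlinarith [norm_nonneg l]
  -- `K` commutes with `A`, so the conjugation by `K` passes through the outer difference in
  -- `defect_eq_sub_conj`. Both the sign and the nonvanishing of the defect are then inherited.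
  have hdef : defect A ((B - l • 1) * K) =
      ((1 - ‖l‖ ^ 2 : ℝ) : ℂ) • (K * defect A B * star K) := by
    have hstar : star K * star A = star A * star K := by rw [← star_mul, ← star_mul, hKA.eq]
    rw [defect_eq_sub_conj, one_sub_moebius hK1 hKB, defect_eq_sub_conj A B, mul_smul_comm,
      smul_mul_assoc, ← smul_sub, mul_sub K (1 - B * star B), sub_mul _ _ (star K)]
    congr 2
    calc A * (K * (1 - B * star B) * star K) * star A
        = A * K * (1 - B * star B) * (star K * star A) := by simp only [mul_assoc]
      _ = K * A * (1 - B * star B) * (star A * star K) := by rw [hKA.eq, hstar]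
      _ = K * (A * (1 - B * star B) * star A) * star K := by simp only [mul_assoc]
  refine ⟨K, hK1, hK2, ⟨h.star_mul_left, star_moebius_mul_moebius h.star_mul_right hK2, ?_, ?_⟩, ?_⟩
  · exact ((hAB.sub_right ((Commute.one_right A).smul_right l)).mul_right hKA.symm).eq
  · rw [hdef]
    have h1 := star_right_conjugate_le_conjugate h.defect_nonpos K
    rw [mul_zero, zero_mul] at h1
    rw [← neg_nonneg, ContinuousLinearMap.nonneg_iff_isPositive] at h1 ⊢
    rw [← smul_neg]
    exact h1.smul_of_nonneg (by exact_mod_cast hpos.le)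
  · rw [hdef]
    intro h0
    refine hne ?_
    have h1 : K * defect A B * star K = 0 :=
      (smul_eq_zero.1 h0).resolve_left (by exact_mod_cast hpos.ne')
    calc defect A B = (1 - starRingEnd ℂ l • B) * K * defect A B *
          star ((1 - starRingEnd ℂ l • B) * K) := by rw [hK2]; simp
      _ = (1 - starRingEnd ℂ l • B) * (K * defect A B * star K) *
          star (1 - starRingEnd ℂ l • B) := by rw [star_mul]; simp only [mul_assoc]
      _ = 0 := by rw [h1]; simp

end Moebius

/-! ### Koszul complexes and the joint spectrum -/

section KoszulLemmas

variable {H : Type*} [NormedAddCommGroup H] [InnerProductSpace ℂ H]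

lemma koszul1_apply (T₁ T₂ : H →L[ℂ] H) (h : H) : koszul1 T₁ T₂ h = (T₁ h, T₂ h) := rfl

lemma koszul2_apply (T₁ T₂ : H →L[ℂ] H) (p : H × H) : koszul2 T₁ T₂ p = T₁ p.2 - T₂ p.1 := rfl

lemma KoszulExact2.exists_eq {T₁ T₂ : H →L[ℂ] H} (h : KoszulExact2 T₁ T₂) {p : H × H}
    (hp : T₁ p.2 = T₂ p.1) : ∃ x, T₁ x = p.1 ∧ T₂ x = p.2 := by
  have : p ∈ LinearMap.ker (koszul2 T₁ T₂) := by
    rw [LinearMap.mem_ker, koszul2_apply, hp, sub_self]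
  rw [← h] at this
  obtain ⟨x, rfl⟩ := this
  exact ⟨x, rfl, rfl⟩

lemma koszulExact2_of_forall {T₁ T₂ : H →L[ℂ] H} (hc : Commute T₁ T₂)
    (h : ∀ p : H × H, T₁ p.2 = T₂ p.1 → ∃ x, T₁ x = p.1 ∧ T₂ x = p.2) : KoszulExact2 T₁ T₂ := by
  refine le_antisymm ?_ fun p hp => ?_
  · rintro _ ⟨x, rfl⟩
    rw [LinearMap.mem_ker, koszul2_apply, koszul1_apply, sub_eq_zero]
    exact DFunLike.congr_fun hc.eq x
  · rw [LinearMap.mem_ker, koszul2_apply, sub_eq_zero] at hp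
    obtain ⟨x, h1, h2⟩ := h p hp
    exact ⟨x, Prod.ext h1 h2⟩

lemma koszulExact1_iff {T₁ T₂ : H →L[ℂ] H} :
    KoszulExact1 T₁ T₂ ↔ Function.Injective (koszul1 T₁ T₂) := by
  rw [KoszulExact1, koszul0, LinearMap.range_zero, eq_comm, LinearMap.ker_eq_bot]

lemma koszulExact3_iff {T₁ T₂ : H →L[ℂ] H} :
    KoszulExact3 T₁ T₂ ↔ Function.Surjective (koszul2 T₁ T₂) := by
  rw [KoszulExact3, koszul3, LinearMap.ker_zero, LinearMap.range_eq_top]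

lemma NonSingular.swap {T₁ T₂ : H →L[ℂ] H} (hc : Commute T₁ T₂) (h : NonSingular T₁ T₂) :
    NonSingular T₂ T₁ := by
  obtain ⟨h1, h2, h3⟩ := h
  rw [koszulExact1_iff] at h1
  rw [koszulExact3_iff] at h3
  refine ⟨koszulExact1_iff.2 fun x y hxy => h1 ?_, koszulExact2_of_forall hc.symm fun p hp => ?_,
    koszulExact3_iff.2 fun y => ?_⟩
  · exact Prod.ext (congrArg Prod.snd hxy) (congrArg Prod.fst hxy)
  · obtain ⟨x, hx1, hx2⟩ := h2.exists_eq (p := p.swap) hp.symm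
    exact ⟨x, hx2, hx1⟩
  -- Exchanging the operators together with the components changes the sign of `δ₂`.
  · obtain ⟨p, hp⟩ := h3 (-y)
    refine ⟨p.swap, ?_⟩
    rw [koszul2_apply] at hp ⊢
    rw [← neg_neg y, ← hp]
    simp

lemma nonSingular_of_isUnit_left {T₁ T₂ : H →L[ℂ] H} (hc : Commute T₁ T₂) (h : IsUnit T₁) :
    NonSingular T₁ T₂ := by
  obtain ⟨u, rfl⟩ := h
  have hl : ∀ x, (↑u⁻¹ : H →L[ℂ] H) ((u : H →L[ℂ] H) x) = x :=
    fun x => DFunLike.congr_fun u.inv_mul x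
  have hr : ∀ x, (u : H →L[ℂ] H) ((↑u⁻¹ : H →L[ℂ] H) x) = x :=
    fun x => DFunLike.congr_fun u.mul_inv x
  have hc' : ∀ x, (↑u⁻¹ : H →L[ℂ] H) (T₂ x) = T₂ ((↑u⁻¹ : H →L[ℂ] H) x) :=
    fun x => DFunLike.congr_fun hc.units_inv_left.eq x
  refine ⟨koszulExact1_iff.2 fun x y hxy => ?_, koszulExact2_of_forall hc fun p hp => ?_,
    koszulExact3_iff.2 fun y => ?_⟩
  · rw [← hl x, ← hl y]
    exact congrArg _ (congrArg Prod.fst hxy)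
  · exact ⟨(↑u⁻¹ : H →L[ℂ] H) p.1, hr _, by rw [← hc', ← hp, hl]⟩
  · exact ⟨(0, (↑u⁻¹ : H →L[ℂ] H) y), by rw [koszul2_apply]; simp [hr]⟩

lemma commute_sub_smul_one {V₁ V₂ : H →L[ℂ] H} (h : Commute V₁ V₂) (a b : ℂ) :
    Commute (V₁ - a • (1 : H →L[ℂ] H)) (V₂ - b • (1 : H →L[ℂ] H)) :=
  (h.sub_right ((Commute.one_right _).smul_right b)).sub_left
    (((Commute.one_left _).smul_left a))

variable [CompleteSpace H]

lemma isUnit_sub_smul_one {V : H →L[ℂ] H} {a : ℂ} (hV : ‖V‖ ≤ 1) (ha : 1 < ‖a‖) :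
    IsUnit (V - a • (1 : H →L[ℂ] H)) := by
  have : ‖a⁻¹ • V‖ < 1 := by
    rw [norm_smul, norm_inv]
    calc ‖a‖⁻¹ * ‖V‖ ≤ ‖a‖⁻¹ * 1 := by gcongr
      _ < 1 := by rw [mul_one]; exact inv_lt_one_of_one_lt₀ ha
  have ha0 : a ≠ 0 := norm_pos_iff.1 (zero_lt_one.trans ha)
  have h2 : V - a • (1 : H →L[ℂ] H) = (Units.mk0 (-a) (neg_ne_zero.2 ha0)) • (1 - a⁻¹ • V) := by
    rw [Units.smul_def, Units.val_mk0, smul_sub, smul_smul, neg_mul, mul_inv_cancel₀ ha0]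
    module
  rw [h2]
  exact (isUnit_one_sub_of_norm_lt_one this).smul _

/-- The operator `δ₂ ⊕ δ₁*` on `H ⊕ H`. -/
def koszulDirac (T₁ T₂ : H →L[ℂ] H) : H × H →L[ℂ] H × H :=
  ContinuousLinearMap.inl ℂ H H ∘L
      (T₁ ∘L ContinuousLinearMap.snd ℂ H H - T₂ ∘L ContinuousLinearMap.fst ℂ H H) +
    ContinuousLinearMap.inr ℂ H H ∘L
      (star T₁ ∘L ContinuousLinearMap.fst ℂ H H + star T₂ ∘L ContinuousLinearMap.snd ℂ H H)

/-- The operator `δ₁* δ₁`. -/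
def koszulLaplacian (T₁ T₂ : H →L[ℂ] H) : H →L[ℂ] H := star T₁ * T₁ + star T₂ * T₂

lemma koszulDirac_apply (T₁ T₂ : H →L[ℂ] H) (p : H × H) :
    koszulDirac T₁ T₂ p = (T₁ p.2 - T₂ p.1, star T₁ p.1 + star T₂ p.2) := by
  simp [koszulDirac]

lemma koszulDirac_koszul1 {T₁ T₂ : H →L[ℂ] H} (hc : Commute T₁ T₂) (x : H) :
    koszulDirac T₁ T₂ (T₁ x, T₂ x) = (0, koszulLaplacian T₁ T₂ x) := by
  rw [koszulDirac_apply]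
  refine Prod.ext ?_ rfl
  exact sub_eq_zero.2 (DFunLike.congr_fun hc.eq x)

lemma inner_koszulLaplacian_self (T₁ T₂ : H →L[ℂ] H) (x : H) :
    ⟪koszulLaplacian T₁ T₂ x, x⟫_ℂ = ((‖T₁ x‖ ^ 2 + ‖T₂ x‖ ^ 2 : ℝ) : ℂ) := by
  have : koszulLaplacian T₁ T₂ x = star T₁ (T₁ x) + star T₂ (T₂ x) := rfl
  rw [this, inner_add_left, inner_star_left, inner_star_left, inner_self_eq_norm_sq_to_K,
    inner_self_eq_norm_sq_to_K]
  push_cast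
  rfl

/-- Exactness makes `δ₁` injective with range `ker δ₂`, hence closed. So `δ₁` is bounded below, and
`δ₁* δ₁` is coercive. -/
lemma NonSingular.isUnit_koszulLaplacian {T₁ T₂ : H →L[ℂ] H} (h : NonSingular T₁ T₂) :
    IsUnit (koszulLaplacian T₁ T₂) := by
  have hr : Set.range (T₁.prod T₂) = {p : H × H | T₁ p.2 = T₂ p.1} := by
    have h2 : (LinearMap.range (koszul1 T₁ T₂) : Set (H × H)) = LinearMap.ker (koszul2 T₁ T₂) :=
      congrArg _ h.2.1
    ext p
    have h3 := Set.ext_iff.1 h2 p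
    refine h3.trans ?_
    rw [SetLike.mem_coe, LinearMap.mem_ker, koszul2_apply, sub_eq_zero]
    rfl
  have hclosed : IsClosed (Set.range (T₁.prod T₂)) := by
    rw [hr]
    exact isClosed_eq (T₁.continuous.comp continuous_snd) (T₂.continuous.comp continuous_fst)
  obtain ⟨c, hc⟩ := (T₁.prod T₂).antilipschitz_of_injective_of_isClosed_range
    (koszulExact1_iff.1 h.1) hclosed
  -- `c + 1` replaces `c` because the antilipschitz constant may be zero and its square is inverted
  -- below. The maximum comes from the sup norm on `H × H`.
  have hb : ∀ x, ‖x‖ ^ 2 ≤ ((c : ℝ) + 1) ^ 2 * (‖T₁ x‖ ^ 2 + ‖T₂ x‖ ^ 2) := by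
    intro x
    have h1 : ‖x‖ ≤ c * max ‖T₁ x‖ ‖T₂ x‖ := by
      simpa [Prod.norm_def] using hc.le_mul_norm_sub (x := x) (y := 0)
    have h2 : max ‖T₁ x‖ ‖T₂ x‖ ^ 2 ≤ ‖T₁ x‖ ^ 2 + ‖T₂ x‖ ^ 2 := by
      rcases max_choice ‖T₁ x‖ ‖T₂ x‖ with h | h <;> rw [h] <;> nlinarith [sq_nonneg ‖T₁ x‖,
        sq_nonneg ‖T₂ x‖]
    have hm : 0 ≤ max ‖T₁ x‖ ‖T₂ x‖ := le_max_of_le_left (norm_nonneg _)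
    calc ‖x‖ ^ 2 ≤ (((c : ℝ) + 1) * max ‖T₁ x‖ ‖T₂ x‖) ^ 2 := by
          gcongr
          exact h1.trans (by gcongr; simp)
      _ ≤ _ := by rw [mul_pow]; gcongr
  refine ContinuousLinearMap.isUnit_of_forall_le_norm_inner_map _ (c := ((c + 1) ^ 2)⁻¹)
    (by positivity) fun x => ?_
  rw [inner_koszulLaplacian_self, Complex.norm_real, Real.norm_of_nonneg (by positivity)]
  push_cast
  rw [← div_eq_mul_inv, div_le_iff₀ (by positivity), mul_comm]
  exact hb x

/-- A kernel vector is some `δ₁ x` by exactness at stage 2, and then `δ₁* δ₁ x = 0`. For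
surjectivity, stage 3 provides the first component, and adding some `δ₁ x` corrects the second
without changing the first. -/
lemma NonSingular.isUnit_koszulDirac {T₁ T₂ : H →L[ℂ] H} (hc : Commute T₁ T₂)
    (h : NonSingular T₁ T₂) : IsUnit (koszulDirac T₁ T₂) := by
  have hS := ContinuousLinearMap.isUnit_iff_bijective.1 h.isUnit_koszulLaplacian
  rw [ContinuousLinearMap.isUnit_iff_bijective]
  constructor
  · rw [injective_iff_map_eq_zero]
    intro p hp
    have hp' := hp
    rw [koszulDirac_apply, Prod.mk_eq_zero, sub_eq_zero] at hp'
    obtain ⟨x, hx1, hx2⟩ := h.2.1.exists_eq hp'.1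
    obtain rfl : p = (T₁ x, T₂ x) := Prod.ext hx1.symm hx2.symm
    rw [koszulDirac_koszul1 hc, Prod.mk_eq_zero] at hp
    obtain rfl : x = 0 := hS.1 (hp.2.trans (map_zero _).symm)
    simp
  · rintro ⟨y, z⟩
    obtain ⟨u, hu⟩ := koszulExact3_iff.1 h.2.2 y
    obtain ⟨x, hx⟩ := hS.2 (z - (star T₁ u.1 + star T₂ u.2))
    refine ⟨u + (T₁ x, T₂ x), ?_⟩
    rw [map_add, koszulDirac_koszul1 hc, hx, koszulDirac_apply]
    rw [koszul2_apply] at hu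
    simp [hu]

/-- For `p` in `ker δ₂`, solve `δ₁* δ₁ x = δ₁* p`. Then `δ₁ x` and `p` have the same image under the
injective operator `δ₂ ⊕ δ₁*`. Invertibility is an open condition, which makes this form of
exactness stable. -/
lemma koszulExact2_of_isUnit {T₁ T₂ : H →L[ℂ] H} (hc : Commute T₁ T₂)
    (hD : IsUnit (koszulDirac T₁ T₂)) (hL : IsUnit (koszulLaplacian T₁ T₂)) :
    KoszulExact2 T₁ T₂ := by
  rw [ContinuousLinearMap.isUnit_iff_bijective] at hD hL
  refine koszulExact2_of_forall hc fun p hp => ?_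
  obtain ⟨x, hx⟩ := hL.2 (star T₁ p.1 + star T₂ p.2)
  have : (T₁ x, T₂ x) = p := by
    refine hD.1 ?_
    rw [koszulDirac_koszul1 hc, hx, koszulDirac_apply, hp, sub_self]
  exact ⟨x, congrArg Prod.fst this, congrArg Prod.snd this⟩

lemma continuous_koszulDirac (V₁ V₂ : H →L[ℂ] H) : Continuous fun l : ℂ × ℂ =>
    koszulDirac (V₁ - l.1 • (1 : H →L[ℂ] H)) (V₂ - l.2 • (1 : H →L[ℂ] H)) := by
  unfold koszulDirac
  fun_prop

lemma continuous_koszulLaplacian (V₁ V₂ : H →L[ℂ] H) : Continuous fun l : ℂ × ℂ =>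
    koszulLaplacian (V₁ - l.1 • (1 : H →L[ℂ] H)) (V₂ - l.2 • (1 : H →L[ℂ] H)) := by
  unfold koszulLaplacian
  fun_prop

lemma eventually_isUnit {X R : Type*} [TopologicalSpace X] [NormedRing R] [CompleteSpace R]
    {f : X → R} (hf : Continuous f) {x : X} (hx : IsUnit (f x)) :
    ∀ᶠ y in nhds x, IsUnit (f y) := by
  have h := (Units.isOpen.preimage hf).mem_nhds (x := x) (by simpa using hx)
  filter_upwards [h] with y hy
  simpa using hy

/-- Points at which the Koszul complex is exact have a neighbourhood on which it is exact at
stage 2. -/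
lemma eventually_koszulExact2 {V₁ V₂ : H →L[ℂ] H} (hc : Commute V₁ V₂) {l : ℂ × ℂ}
    (hl : l ∉ jointSpectrum V₁ V₂) : ∀ᶠ m : ℂ × ℂ in nhds l,
      KoszulExact2 (V₁ - m.1 • (1 : H →L[ℂ] H)) (V₂ - m.2 • (1 : H →L[ℂ] H)) := by
  have hn : NonSingular (V₁ - l.1 • (1 : H →L[ℂ] H)) (V₂ - l.2 • (1 : H →L[ℂ] H)) := not_not.1 hl
  have h1 := eventually_isUnit (R := H × H →L[ℂ] H × H) (x := l)
    (continuous_koszulDirac V₁ V₂) (hn.isUnit_koszulDirac (commute_sub_smul_one hc _ _))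
  have h2 := eventually_isUnit (R := H →L[ℂ] H) (x := l)
    (continuous_koszulLaplacian V₁ V₂) hn.isUnit_koszulLaplacian
  filter_upwards [h1, h2] with m hm1 hm2
  exact koszulExact2_of_isUnit (commute_sub_smul_one hc _ _) hm1 hm2

/-- A defect vector of the transformed pair lies in both ranges, which yields a cycle at stage 2. If
that cycle were a boundary, the vector would lie in the range of the product, whose adjoint kills
it. -/
lemma IsNegPair.not_koszulExact2 {A B : H →L[ℂ] H} (h : IsNegPair A B) (hne : defect A B ≠ 0)
    {a b : ℂ} (ha : ‖a‖ < 1) (hb : ‖b‖ < 1) :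
    ¬ KoszulExact2 (A - a • (1 : H →L[ℂ] H)) (B - b • (1 : H →L[ℂ] H)) := by
  intro hex
  obtain ⟨K₂, hK₂, -, h', hne'⟩ := h.exists_moebius hne hb
  obtain ⟨K₁, hK₁, -, h'', hne''⟩ := h'.symm.exists_moebius (defect_comm h'.comm ▸ hne') ha
  set S := A - a • (1 : H →L[ℂ] H) with hS
  set T := B - b • (1 : H →L[ℂ] H) with hT
  refine hne'' (ContinuousLinearMap.ext fun y => ?_)
  have hx := h''.isDefectVector_defect y
  set x := defect (T * K₂) (S * K₁) y
  obtain ⟨z, hz1, hz2⟩ := hex.exists_eq (p := (K₂ (star (T * K₂) x), K₁ (star (S * K₁) x)))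
    (hx.right.trans hx.left.symm)
  have hx1 : S (T z) = x := by rw [hz2]; exact hx.right
  have hN : Commute (1 - starRingEnd ℂ a • A) T := by
    have hAB : Commute A B := h.comm
    have : Commute A T := hAB.sub_right ((Commute.one_right _).smul_right b)
    exact (Commute.one_left _).sub_left (this.smul_left _)
  -- Cancelling the inverses `K₁`, `K₂` shows that `ran S T` lies in the range of the product of the
  -- Möbius transforms.
  have hop : (S * K₁) * (T * K₂) * ((1 - starRingEnd ℂ b • B) * (1 - starRingEnd ℂ a • A)) =
      S * T := by
    calc _ = S * K₁ * T * (K₂ * (1 - starRingEnd ℂ b • B)) * (1 - starRingEnd ℂ a • A) := by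
          simp only [mul_assoc]
      _ = S * (K₁ * (1 - starRingEnd ℂ a • A)) * T := by
          rw [hK₂, mul_one]; simp only [mul_assoc]; rw [hN.eq]
      _ = S * T := by rw [hK₁, mul_one]
  obtain ⟨k, hk⟩ : ∃ k, (T * K₂) ((S * K₁) k) = x := by
    refine ⟨((1 - starRingEnd ℂ b • B) * (1 - starRingEnd ℂ a • A)) z, ?_⟩
    rw [h''.comm_apply, ← hx1]
    exact DFunLike.congr_fun hop z
  have h0 := hx.symm h'' |>.star_left_star_right
  rw [← hk, h''.star_apply_left, h''.symm.star_apply_left] at h0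
  rw [← hk, h0]
  simp

lemma IsNegPair.jointSpectrum_eq {A B : H →L[ℂ] H} (h : IsNegPair A B) (hne : defect A B ≠ 0) :
    jointSpectrum A B = Metric.closedBall (0 : ℂ) 1 ×ˢ Metric.closedBall (0 : ℂ) 1 := by
  ext ⟨a, b⟩
  rw [Set.mem_prod, mem_closedBall_zero_iff, mem_closedBall_zero_iff]
  constructor
  · intro hab
    by_contra! hcon
    refine hab ?_
    have hc := commute_sub_smul_one h.comm a b
    by_cases ha : ‖a‖ ≤ 1
    · exact (nonSingular_of_isUnit_left hc.symm (isUnit_sub_smul_one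
        (norm_le_one_of_star_mul_self h.star_mul_right) (hcon ha))).swap hc.symm
    · exact nonSingular_of_isUnit_left hc (isUnit_sub_smul_one
        (norm_le_one_of_star_mul_self h.star_mul_left) (not_le.1 ha))
  · rintro ⟨ha, hb⟩
    by_contra hab
    -- Stage 2 would be exact throughout a neighbourhood of `(a, b)`, but this neighbourhood meets
    -- the open bidisc.
    have hcl : (a, b) ∈ closure (Metric.ball (0 : ℂ) 1 ×ˢ Metric.ball (0 : ℂ) 1) := by
      rw [closure_prod_eq, closure_ball _ one_ne_zero]
      exact ⟨mem_closedBall_zero_iff.2 ha, mem_closedBall_zero_iff.2 hb⟩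
    obtain ⟨m, hm1, hm2⟩ := (mem_closure_iff_frequently.1 hcl).and_eventually
      (eventually_koszulExact2 h.comm hab) |>.exists
    exact h.not_koszulExact2 hne (mem_ball_zero_iff.1 hm1.1) (mem_ball_zero_iff.1 hm1.2) hm2

end KoszulLemmas

section PowerCommute

variable {H : Type*} [NormedAddCommGroup H] [InnerProductSpace ℂ H]

lemma clm_mul_apply (S T : H →L[ℂ] H) (x : H) : (S * T) x = S (T x) := rfl

lemma mul_pow_apply_comm {A B T : H →L[ℂ] H} (hT : Commute T (A * B)) (n : ℕ) (x : H) :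
    T (((A * B) ^ n) x) = ((A * B) ^ n) (T x) :=
  DFunLike.congr_fun (hT.pow_right n).eq x

end PowerCommute

/-! ### The vectors that correspond to monomials -/

section ModelVectors

variable {H : Type*} [NormedAddCommGroup H] [InnerProductSpace ℂ H] [CompleteSpace H]

/-- The operator that maps a defect vector to the vector that corresponds to the monomial
`z₁^m z₂^n`. -/
def modelShift (A B : H →L[ℂ] H) (k : ℕ × ℕ) : H →L[ℂ] H :=
  (A * B) ^ min k.1 k.2 *
    if k.2 ≤ k.1 then star A ^ (k.1 - k.2 + 1) else star B ^ (k.2 - k.1 - 1)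

lemma modelShift_lower (A B : H →L[ℂ] H) (n d : ℕ) :
    modelShift A B (n + d, n) = (A * B) ^ n * star A ^ (d + 1) := by
  simp [modelShift]

lemma modelShift_upper (A B : H →L[ℂ] H) (n d : ℕ) :
    modelShift A B (n, n + 1 + d) = (A * B) ^ n * star B ^ d := by
  have h1 : ¬ n + 1 + d ≤ n := by omega
  have h2 : n + 1 + d - n - 1 = d := by omega
  have h3 : min n (n + 1 + d) = n := by omega
  simp only [modelShift, h1, h2, h3, if_false]

lemma exists_lower_or_upper (k : ℕ × ℕ) :
    (∃ n d, k = (n + d, n)) ∨ ∃ n d, k = (n, n + 1 + d) := by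
  obtain ⟨m, n⟩ := k
  rcases le_or_gt n m with h | h
  · exact Or.inl ⟨n, m - n, Prod.ext (by dsimp; omega) rfl⟩
  · exact Or.inr ⟨m, n - m - 1, Prod.ext rfl (by dsimp; omega)⟩

lemma IsNegPair.star_mul_mul_self {A B : H →L[ℂ] H} (h : IsNegPair A B) :
    star (A * B) * (A * B) = 1 := by
  rw [star_mul, mul_assoc, ← mul_assoc (star A), h.star_mul_left, one_mul, h.star_mul_right]

/-- `ker V*` is a wandering subspace of the isometry `V`. -/
lemma inner_pow_apply_of_star_eq_zero {V : H →L[ℂ] H} (hV : star V * V = 1) {x y : H}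
    (hx : star V x = 0) (hy : star V y = 0) (m n : ℕ) :
    ⟪(V ^ m) x, (V ^ n) y⟫_ℂ = if m = n then ⟪x, y⟫_ℂ else 0 := by
  induction m generalizing n with
  | zero =>
    cases n with
    | zero => simp
    | succ n =>
      have : ⟪x, V ((V ^ n) y)⟫_ℂ = 0 := by rw [← inner_star_left, hx, inner_zero_left]
      simpa [pow_succ'] using this
  | succ m ih =>
    cases n with
    | zero =>
      have : ⟪V ((V ^ m) x), y⟫_ℂ = 0 := by rw [← inner_star_right, hy, inner_zero_right]
      simpa [pow_succ'] using this
    | succ n =>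
      have h1 : star V (V ((V ^ m) x)) = (V ^ m) x := DFunLike.congr_fun hV _
      have : ⟪V ((V ^ m) x), V ((V ^ n) y)⟫_ℂ = ⟪(V ^ m) x, (V ^ n) y⟫_ℂ := by
        rw [← inner_star_left, h1]
      rw [pow_succ', pow_succ', clm_mul_apply, clm_mul_apply,
        this, ih]
      simp

lemma IsNegPair.star_left_eq {A B : H →L[ℂ] H} (h : IsNegPair A B) {x y : H} (hy : A y = x) :
    star A x = y := by
  rw [← hy, h.star_apply_left]

namespace IsDefectVector

variable {A B : H →L[ℂ] H} {x y : H}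

lemma star_right_star_left_pow (h : IsNegPair A B) (hx : IsDefectVector A B x) (n : ℕ) :
    star B ((star A ^ (n + 1)) x) = 0 := by
  have hc : Commute (star B) (star A) := by
    rw [commute_iff_eq, ← star_mul, ← star_mul, h.comm]
  have : star B ((star A ^ n) (star A x)) = (star A ^ n) (star B (star A x)) :=
    DFunLike.congr_fun (hc.pow_right n).eq _
  rw [pow_succ, clm_mul_apply, this, ← h.star_comm_apply,
    hx.star_left_star_right, map_zero]

/-- For positive `n`, `A*^n x` lies in `ker B*`, hence in `ran A`; for `n = 0`, `x` itself is in
`ran A`. -/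
lemma left_star_left_pow (h : IsNegPair A B) (hx : IsDefectVector A B x) (n : ℕ) :
    A ((star A ^ (n + 1)) x) = (star A ^ n) x := by
  rw [pow_succ', clm_mul_apply]
  cases n with
  | zero => exact hx.left
  | succ n => exact h.symm.right_star_right_of_star_left_eq_zero (hx.star_right_star_left_pow h n)

/-- Equal numbers of `A*` cancel by `left_star_left_pow`. Any surplus leaves a vector of `ker B*`,
to which defect vectors are orthogonal. -/
lemma inner_star_left_pow (h : IsNegPair A B) (hx : IsDefectVector A B x)
    (hy : IsDefectVector A B y) (m n : ℕ) :
    ⟪(star A ^ m) x, (star A ^ n) y⟫_ℂ = if m = n then ⟪x, y⟫_ℂ else 0 := by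
  induction m generalizing n with
  | zero =>
    cases n with
    | zero => simp
    | succ n =>
      simpa using (hx.symm h).inner_eq_zero h.symm (hy.star_right_star_left_pow h n)
  | succ m ih =>
    cases n with
    | zero =>
      have h0 := (hy.symm h).inner_eq_zero h.symm (hx.star_right_star_left_pow h m)
      rw [pow_zero, ← inner_conj_symm]
      exact (congrArg _ h0).trans (by simp)
    | succ n =>
      rw [pow_succ', clm_mul_apply, inner_star_left, hy.left_star_left_pow h, ih]
      simp

/-- For positive `n` the second vector is in `ker A* ⊆ ran B`, while the first is in `ker B*`. -/
lemma inner_star_left_pow_star_right_pow (h : IsNegPair A B) (hx : IsDefectVector A B x)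
    (hy : IsDefectVector A B y) (m n : ℕ) :
    ⟪(star A ^ (m + 1)) x, (star B ^ n) y⟫_ℂ = 0 := by
  cases n with
  | zero => simpa using hx.inner_star_left_pow h hy (m + 1) 0
  | succ n =>
    have h1 := (hy.symm h).star_right_star_left_pow h.symm n
    rw [← h.right_star_right_of_star_left_eq_zero h1, ← inner_star_left,
      hx.star_right_star_left_pow h, inner_zero_left]

lemma star_mul_star_left_pow (h : IsNegPair A B) (hx : IsDefectVector A B x) (n : ℕ) :
    star (A * B) ((star A ^ n) x) = 0 := by
  rw [star_mul, clm_mul_apply, ← clm_mul_apply (star A),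
    ← pow_succ', hx.star_right_star_left_pow h]

lemma star_mul_star_right_pow (h : IsNegPair A B) (hx : IsDefectVector A B x) (n : ℕ) :
    star (A * B) ((star B ^ n) x) = 0 := by
  rw [h.comm]
  exact (hx.symm h).star_mul_star_left_pow h.symm n

/-- Different powers of `V` are separated by wandering, and equal ones reduce to the two chains. The
`A*` chain starts at exponent 1 and the `B*` chain at 0, so `x` occurs only once, at the index `(0,
1)`. -/
lemma inner_modelShift (h : IsNegPair A B) (hx : IsDefectVector A B x)
    (hy : IsDefectVector A B y) (k l : ℕ × ℕ) :
    ⟪modelShift A B k x, modelShift A B l y⟫_ℂ = if k = l then ⟪x, y⟫_ℂ else 0 := by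
  have hV := h.star_mul_mul_self
  rcases exists_lower_or_upper k with ⟨m, c, rfl⟩ | ⟨m, c, rfl⟩ <;>
  rcases exists_lower_or_upper l with ⟨n, d, rfl⟩ | ⟨n, d, rfl⟩ <;>
  simp only [modelShift_lower, modelShift_upper, clm_mul_apply]
  · rw [inner_pow_apply_of_star_eq_zero hV (hx.star_mul_star_left_pow h _)
      (hy.star_mul_star_left_pow h _), hx.inner_star_left_pow h hy, ← ite_and]
    refine if_congr ?_ rfl rfl
    rw [Prod.mk.injEq]
    omega
  · rw [inner_pow_apply_of_star_eq_zero hV (hx.star_mul_star_left_pow h _)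
      (hy.star_mul_star_right_pow h _), hx.inner_star_left_pow_star_right_pow h hy, ite_self,
      if_neg]
    rw [Prod.mk.injEq]
    omega
  · rw [inner_pow_apply_of_star_eq_zero hV (hx.star_mul_star_right_pow h _)
      (hy.star_mul_star_left_pow h _), ← inner_conj_symm,
      hy.inner_star_left_pow_star_right_pow h hx, map_zero, ite_self, if_neg]
    rw [Prod.mk.injEq]
    omega
  · rw [inner_pow_apply_of_star_eq_zero hV (hx.star_mul_star_right_pow h _)
      (hy.star_mul_star_right_pow h _), (hx.symm h).inner_star_left_pow h.symm (hy.symm h),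
      ← ite_and]
    refine if_congr ?_ rfl rfl
    rw [Prod.mk.injEq]
    omega

lemma commute_left_mul (h : IsNegPair A B) : Commute A (A * B) := by
  have hc : Commute A B := h.comm
  exact (Commute.refl A).mul_right hc

lemma commute_right_mul (h : IsNegPair A B) : Commute B (A * B) := by
  have hc : Commute B A := h.comm.symm
  exact hc.mul_right (Commute.refl B)

lemma left_modelShift_diag (h : IsNegPair A B) (hx : IsDefectVector A B x) (n : ℕ) :
    A (modelShift A B (n, n) x) = modelShift A B (n, n + 1) x := by
  have h1 := modelShift_lower A B n 0
  have h2 := modelShift_upper A B n 0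
  simp only [add_zero] at h1 h2
  rw [h1, h2, clm_mul_apply, mul_pow_apply_comm (commute_left_mul h),
    hx.left_star_left_pow h]
  rfl

lemma left_modelShift_lower (h : IsNegPair A B) (hx : IsDefectVector A B x) (n d : ℕ) :
    A (modelShift A B (n + (d + 1), n) x) = modelShift A B (n + d, n) x := by
  rw [modelShift_lower, modelShift_lower, clm_mul_apply,
    mul_pow_apply_comm (commute_left_mul h), hx.left_star_left_pow h]
  rfl

lemma left_modelShift_upper (h : IsNegPair A B) (hx : IsDefectVector A B x) (n d : ℕ) :
    A (modelShift A B (n, n + 1 + d) x) = modelShift A B (n + 1, n + 1 + 1 + (d + 1)) x := by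
  rw [modelShift_upper, modelShift_upper, clm_mul_apply,
    mul_pow_apply_comm (commute_left_mul h), ← (hx.symm h).left_star_left_pow h.symm,
    pow_succ (A * B)]
  rfl

lemma right_modelShift_lower (h : IsNegPair A B) (hx : IsDefectVector A B x) (n d : ℕ) :
    B (modelShift A B (n + d, n) x) = modelShift A B (n + 1 + (d + 1), n + 1) x := by
  rw [modelShift_lower, modelShift_lower, clm_mul_apply,
    mul_pow_apply_comm (commute_right_mul h), ← hx.left_star_left_pow h, pow_succ (A * B), h.comm]
  rfl

lemma right_modelShift_succ (h : IsNegPair A B) (hx : IsDefectVector A B x) (n : ℕ) :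
    B (modelShift A B (n, n + 1) x) = modelShift A B (n + 1, n + 1) x := by
  have h1 := modelShift_lower A B (n + 1) 0
  have h2 := modelShift_upper A B n 0
  simp only [add_zero] at h1 h2
  rw [h1, h2, clm_mul_apply, mul_pow_apply_comm (commute_right_mul h), pow_succ (A * B), h.comm]
  -- Writing `x` as `A A* x` lets the new factor `B` complete one more power of `V`.
  have h3 := hx.left_star_left_pow h 0
  exact congrArg (fun z => ((B * A) ^ n) (B z)) h3.symm

lemma right_modelShift_upper (h : IsNegPair A B) (hx : IsDefectVector A B x) (n d : ℕ) :
    B (modelShift A B (n, n + 1 + (d + 1)) x) = modelShift A B (n, n + 1 + d) x := by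
  rw [modelShift_upper, modelShift_upper, clm_mul_apply,
    mul_pow_apply_comm (commute_right_mul h), (hx.symm h).left_star_left_pow h.symm]
  rfl

/-- The index moves exactly as the exponents do under `τ₁` in `tau1_monomial`; `right_modelShift` is
the counterpart for `τ₂`. -/
lemma left_modelShift (h : IsNegPair A B) (hx : IsDefectVector A B x) (k : ℕ × ℕ) :
    A (modelShift A B k x) =
      modelShift A B (HardyBidisc.exponentPerm.symm (k.1 + 1, k.2)) x := by
  rcases exists_lower_or_upper k with ⟨n, d, rfl⟩ | ⟨n, d, rfl⟩
  · cases d with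
    | zero =>
      rw [add_zero, hx.left_modelShift_diag h]
      congr 2
      rw [Equiv.eq_symm_apply]
      simp [HardyBidisc.exponentPerm]
    | succ d =>
      rw [hx.left_modelShift_lower h]
      congr 2
      rw [Equiv.eq_symm_apply]
      simp [HardyBidisc.exponentPerm]
      omega
  · rw [hx.left_modelShift_upper h]
    congr 2
    rw [Equiv.eq_symm_apply]
    simp [HardyBidisc.exponentPerm]
    split_ifs <;> grind

lemma right_modelShift (h : IsNegPair A B) (hx : IsDefectVector A B x) (k : ℕ × ℕ) :
    B (modelShift A B k x) = modelShift A B ((HardyBidisc.exponentPerm k).1,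
      (HardyBidisc.exponentPerm k).2 + 1) x := by
  rcases exists_lower_or_upper k with ⟨n, d, rfl⟩ | ⟨n, d, rfl⟩
  · rw [hx.right_modelShift_lower h]
    congr 2
    simp [HardyBidisc.exponentPerm]
    omega
  · cases d with
    | zero =>
      rw [add_zero, hx.right_modelShift_succ h]
      congr 2
      simp [HardyBidisc.exponentPerm]
    | succ d =>
      rw [hx.right_modelShift_upper h]
      congr 2
      simp [HardyBidisc.exponentPerm]
      split_ifs <;> grind

/-- Needed for the closed span to be reducing. `A*` inverts `A` on indices outside the boundary part
`(0, d + 2)`, where it gives zero; `B*` likewise gives zero at `(d, 0)`. -/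
lemma star_left_modelShift (h : IsNegPair A B) (hx : IsDefectVector A B x) (k : ℕ × ℕ) :
    star A (modelShift A B k x) = 0 ∨
      ∃ l, star A (modelShift A B k x) = modelShift A B l x := by
  rcases exists_lower_or_upper k with ⟨n, d, rfl⟩ | ⟨n, d, rfl⟩
  · exact Or.inr ⟨_, h.star_left_eq (hx.left_modelShift_lower h _ _)⟩
  · cases d with
    | zero => exact Or.inr ⟨_, h.star_left_eq (hx.left_modelShift_diag h _)⟩
    | succ d =>
      cases n with
      | zero =>
        rw [modelShift_upper, pow_zero, one_mul]
        exact Or.inl ((hx.symm h).star_right_star_left_pow h.symm d)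
      | succ n => exact Or.inr ⟨_, h.star_left_eq (hx.left_modelShift_upper h _ _)⟩

lemma star_right_modelShift (h : IsNegPair A B) (hx : IsDefectVector A B x) (k : ℕ × ℕ) :
    star B (modelShift A B k x) = 0 ∨
      ∃ l, star B (modelShift A B k x) = modelShift A B l x := by
  rcases exists_lower_or_upper k with ⟨n, d, rfl⟩ | ⟨n, d, rfl⟩
  · cases n with
    | zero =>
      rw [modelShift_lower, pow_zero, one_mul]
      exact Or.inl (hx.star_right_star_left_pow h d)
    | succ n =>
      cases d with
      | zero =>
        exact Or.inr ⟨_, h.symm.star_left_eq (hx.right_modelShift_succ h _)⟩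
      | succ d => exact Or.inr ⟨_, h.symm.star_left_eq (hx.right_modelShift_lower h _ _)⟩
  · exact Or.inr ⟨_, h.symm.star_left_eq (hx.right_modelShift_upper h _ _)⟩

end IsDefectVector

end ModelVectors

/-! ### Action of the fundamental pair on monomials -/

namespace HardyBidisc

lemma mulZ1_monomial (k : ℕ × ℕ) : mulZ1 (monomialBasis k) = monomialBasis (k.1 + 1, k.2) := by
  refine Subtype.ext (funext fun z => ?_)
  refine (mulZ1_apply _ z).trans (Eq.trans ?_ (monomialBasis_apply _ z).symm)
  rw [monomialBasis_apply, monomialFun, monomialFun]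
  ring

lemma mulZ2_monomial (k : ℕ × ℕ) : mulZ2 (monomialBasis k) = monomialBasis (k.1, k.2 + 1) := by
  refine Subtype.ext (funext fun z => ?_)
  refine (mulZ2_apply _ z).trans (Eq.trans ?_ (monomialBasis_apply _ z).symm)
  rw [monomialBasis_apply, monomialFun, monomialFun]
  ring

lemma tau1_monomial (k : ℕ × ℕ) :
    tau1 (monomialBasis k) = monomialBasis (exponentPerm.symm (k.1 + 1, k.2)) := by
  change unitaryU.symm (mulZ1 (monomialBasis k)) = _
  rw [LinearIsometryEquiv.symm_apply_eq, unitaryU_monomial, Equiv.apply_symm_apply, mulZ1_monomial]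

lemma tau2_monomial (k : ℕ × ℕ) :
    tau2 (monomialBasis k) = monomialBasis ((exponentPerm k).1, (exponentPerm k).2 + 1) := by
  change mulZ2 (unitaryU (monomialBasis k)) = _
  rw [unitaryU_monomial, mulZ2_monomial]

end HardyBidisc

/-! ### Orthonormal bases and tensor products -/

section HilbertBases

variable {ι κ E F G : Type*} [NormedAddCommGroup E] [InnerProductSpace ℂ E]
  [NormedAddCommGroup F] [InnerProductSpace ℂ F] [NormedAddCommGroup G] [NormedSpace ℂ G]

lemma forall_mem_of_hilbertBasis (b : HilbertBasis ι ℂ E) (f : E →L[ℂ] G) {M : Submodule ℂ G}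
    (hM : IsClosed (M : Set G)) (h : ∀ i, f (b i) ∈ M) (x : E) : f x ∈ M := by
  have h1 : (Submodule.span ℂ (Set.range b)).topologicalClosure ≤ M.comap f.toLinearMap := by
    refine Submodule.topologicalClosure_minimal _ (Submodule.span_le.2 ?_)
      (hM.preimage f.continuous)
    rintro _ ⟨i, rfl⟩
    exact h i
  rw [b.dense_span] at h1
  exact h1 Submodule.mem_top

lemma ext_hilbertBasis (b : HilbertBasis ι ℂ E) {f g : E →L[ℂ] G} (h : ∀ i, f (b i) = g (b i)) :
    f = g := by
  ext x
  have h1 := forall_mem_of_hilbertBasis b (f - g) (M := ⊥) isClosed_singleton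
    (fun i => by simp [h i]) x
  exact sub_eq_zero.1 h1

lemma orthonormal_tmul {b : ι → E} {c : κ → F} (hb : Orthonormal ℂ b) (hc : Orthonormal ℂ c) :
    Orthonormal ℂ fun p : ι × κ => ((b p.1 ⊗ₜ[ℂ] c p.2 : E ⊗[ℂ] F) : HilbertTensor E F) := by
  classical
  rw [orthonormal_iff_ite] at hb hc ⊢
  rintro ⟨i, j⟩ ⟨i', j'⟩
  rw [UniformSpace.Completion.inner_coe, TensorProduct.inner_tmul, hb, hc, ite_zero_mul_ite_zero,
    mul_one]
  simp only [Prod.mk.injEq]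

/-- The tensors of basis vectors form an orthonormal basis of the Hilbert tensor product. -/
def tensorBasis (b : HilbertBasis ι ℂ E) (c : HilbertBasis κ ℂ F) :
    HilbertBasis (ι × κ) ℂ (HilbertTensor E F) :=
  HilbertBasis.mk (orthonormal_tmul b.orthonormal c.orthonormal) (by
    set M := (Submodule.span ℂ (Set.range fun p : ι × κ =>
      ((b p.1 ⊗ₜ[ℂ] c p.2 : E ⊗[ℂ] F) : HilbertTensor E F))).topologicalClosure
    have hM : IsClosed (M : Set (HilbertTensor E F)) := Submodule.isClosed_topologicalClosure _
    let toCompletion : E ⊗[ℂ] F →L[ℂ] HilbertTensor E F := UniformSpace.Completion.toComplL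
    -- Elementary tensors are reached one factor at a time, by continuity of the tensor product in
    -- each variable.
    have h1 : ∀ i y, ((b i ⊗ₜ[ℂ] y : E ⊗[ℂ] F) : HilbertTensor E F) ∈ M := fun i =>
      forall_mem_of_hilbertBasis c (toCompletion ∘L TensorProduct.mkL ℂ E F (b i))
        hM fun j => Submodule.le_topologicalClosure _ (Submodule.subset_span ⟨(i, j), rfl⟩)
    have h2 : ∀ x y, ((x ⊗ₜ[ℂ] y : E ⊗[ℂ] F) : HilbertTensor E F) ∈ M := fun x y =>
      forall_mem_of_hilbertBasis b
        (toCompletion ∘L (TensorProduct.mkL ℂ E F).flip y) hM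
        (fun i => h1 i y) x
    intro z _
    refine UniformSpace.Completion.induction_on z hM fun t => ?_
    induction t with
    | zero => exact M.zero_mem
    | add s t hs ht =>
      rw [UniformSpace.Completion.coe_add]
      exact M.add_mem hs ht
    | tmul x y => exact h2 x y)

lemma tensorBasis_apply (b : HilbertBasis ι ℂ E) (c : HilbertBasis κ ℂ F) (p : ι × κ) :
    tensorBasis b c p = ((b p.1 ⊗ₜ[ℂ] c p.2 : E ⊗[ℂ] F) : HilbertTensor E F) := by
  rw [tensorBasis, HilbertBasis.coe_mk]

lemma tensorId_coe_tmul (T : E →ₗᵢ[ℂ] E) (x : E) (y : F) :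
    tensorId T F ((x ⊗ₜ[ℂ] y : E ⊗[ℂ] F) : HilbertTensor E F) =
      ((T x ⊗ₜ[ℂ] y : E ⊗[ℂ] F) : HilbertTensor E F) := by
  rw [tensorId, ContinuousLinearMap.completion_apply_coe]
  rfl

lemma mem_orthogonal_closure_span_range {u : ι → E} {y : E} :
    y ∈ (Submodule.span ℂ (Set.range u)).topologicalClosureᗮ ↔ ∀ i, ⟪u i, y⟫_ℂ = 0 := by
  rw [Submodule.orthogonal_closure, Submodule.mem_orthogonal]
  refine ⟨fun h i => h _ (Submodule.subset_span ⟨i, rfl⟩), fun h v hv => ?_⟩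
  induction hv using Submodule.span_induction with
  | mem v hv => obtain ⟨i, rfl⟩ := hv; exact h i
  | zero => exact inner_zero_left _
  | add v w _ _ hv hw => rw [inner_add_left, hv, hw, add_zero]
  | smul a v _ hv => rw [inner_smul_left, hv, mul_zero]

lemma exists_equiv_closure_span [CompleteSpace F] (t : HilbertBasis ι ℂ E) {u : ι → F}
    (hu : Orthonormal ℂ u) :
    ∃ Φ : E ≃ₗᵢ[ℂ] (Submodule.span ℂ (Set.range u)).topologicalClosure,
      ∀ i, (Φ (t i) : F) = u i := by
  classical
  set M := (Submodule.span ℂ (Set.range u)).topologicalClosure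
  have hmem : ∀ i, u i ∈ M := fun i =>
    Submodule.le_topologicalClosure _ (Submodule.subset_span ⟨i, rfl⟩)
  have hMc : IsClosed (M : Set F) := Submodule.isClosed_topologicalClosure _
  have : CompleteSpace M := hMc.completeSpace_coe
  have hu' := hu.codRestrict M hmem
  let b := HilbertBasis.mkOfOrthogonalEqBot hu' (by
    rw [Submodule.eq_bot_iff]
    intro y hy
    have h1 : ∀ i, ⟪u i, (y : F)⟫_ℂ = 0 := fun i =>
      (Submodule.mem_orthogonal _ _).1 hy _ (Submodule.subset_span ⟨i, rfl⟩)
    have h2 : (y : F) ∈ Mᗮ := mem_orthogonal_closure_span_range.2 h1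
    exact Subtype.ext (inner_self_eq_zero.1 (h2 y y.2)))
  refine ⟨t.repr.trans b.repr.symm, fun i => ?_⟩
  rw [LinearIsometryEquiv.trans_apply, t.repr_self, HilbertBasis.repr_symm_single,
    HilbertBasis.coe_mkOfOrthogonalEqBot]
  rfl

end HilbertBases

/-! ### Splitting off the model -/

section Decomposition

variable {H : Type*} [NormedAddCommGroup H] [InnerProductSpace ℂ H] [CompleteSpace H]

/-- Invariance under `T*` as well is essential: otherwise the adjoint of the restriction is only a
compression of `T*`. -/
lemma coe_star_restrict {K : Submodule ℂ H} [CompleteSpace K] {T : H →L[ℂ] H}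
    (hT : Set.MapsTo T K K) (hT' : Set.MapsTo ⇑(star T) K K) (x : K) :
    ((star (T.restrict hT) x : K) : H) = star T x := by
  have : star (T.restrict hT) x = ⟨star T x, hT' x.2⟩ := by
    refine ext_inner_right ℂ fun y => ?_
    rw [inner_star_left, Submodule.coe_inner, Submodule.coe_inner]
    exact (inner_star_left T (x : H) (y : H)).symm
  rw [this]

lemma coe_defect_restrict {K : Submodule ℂ H} [CompleteSpace K] {A B : H →L[ℂ] H}
    (hA : Set.MapsTo A K K) (hB : Set.MapsTo B K K) (hA' : Set.MapsTo ⇑(star A) K K)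
    (hB' : Set.MapsTo ⇑(star B) K K) (x : K) :
    ((defect (A.restrict hA) (B.restrict hB) x : K) : H) = defect A B x := by
  have hr : ∀ {T : H →L[ℂ] H} (hT : Set.MapsTo T K K) (z : K), ((T.restrict hT z : K) : H) = T z :=
    fun _ _ => rfl
  simp only [defect_apply, Submodule.coe_add, Submodule.coe_sub, hr, coe_star_restrict hA hA',
    coe_star_restrict hB hB']

lemma mapsTo_orthogonal_closure_span {ι : Type*} {u : ι → H} {T : H →L[ℂ] H}
    (h : ∀ i, star T (u i) = 0 ∨ ∃ j, star T (u i) = u j) :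
    Set.MapsTo T ((Submodule.span ℂ (Set.range u)).topologicalClosureᗮ : Submodule ℂ H)
      ((Submodule.span ℂ (Set.range u)).topologicalClosureᗮ : Submodule ℂ H) := by
  intro y hy
  rw [SetLike.mem_coe, mem_orthogonal_closure_span_range] at hy ⊢
  intro i
  rw [← inner_star_left]
  rcases h i with h0 | ⟨j, hj⟩
  · rw [h0, inner_zero_left]
  · rw [hj, hy]

lemma IsNegPair.exists_decomposition {A B : H →L[ℂ] H} (h : IsNegPair A B) :
    ∃ H₀ : Submodule ℂ H, IsClosed (H₀ : Set H) ∧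
      ∃ Φ : HilbertTensor HardyBidisc (LinearMap.range (defect A B).toLinearMap) ≃ₗᵢ[ℂ] H₀,
        (∀ x, A (Φ x) = Φ (tensorId HardyBidisc.tau1 _ x)) ∧
        (∀ x, B (Φ x) = Φ (tensorId HardyBidisc.tau2 _ x)) ∧
        ∃ (h₁ : Set.MapsTo A H₀ᗮ H₀ᗮ) (h₂ : Set.MapsTo B H₀ᗮ H₀ᗮ),
          defect (A.restrict h₁) (B.restrict h₂) = 0 := by
  classical
  set L := LinearMap.range (defect A B).toLinearMap with hL
  have : CompleteSpace L := h.isClosed_range_defect.completeSpace_coe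
  obtain ⟨w, b, -⟩ := exists_hilbertBasis ℂ L
  have hb : ∀ i, IsDefectVector A B (b i : H) := fun i => h.mem_range_defect.1 (b i).2
  let u : (ℕ × ℕ) × w → H := fun p => modelShift A B p.1 (b p.2)
  have hu : Orthonormal ℂ u := by
    rw [orthonormal_iff_ite]
    rintro ⟨k, i⟩ ⟨l, j⟩
    have h1 := (orthonormal_iff_ite.1 b.orthonormal) i j
    rw [Submodule.coe_inner] at h1
    rw [(hb i).inner_modelShift h (hb j), h1, ← ite_and]
    simp only [Prod.mk.injEq]
  let t := tensorBasis HardyBidisc.monomialBasis b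
  let H₀ := (Submodule.span ℂ (Set.range u)).topologicalClosure
  obtain ⟨Φ, hΦ⟩ : ∃ Φ : HilbertTensor HardyBidisc L ≃ₗᵢ[ℂ] H₀, ∀ p, (Φ (t p) : H) = u p :=
    exists_equiv_closure_span t hu
  have hcl : IsClosed (H₀ : Set H) := Submodule.isClosed_topologicalClosure _
  have hint : ∀ (T : H →L[ℂ] H) (τ : HardyBidisc →ₗᵢ[ℂ] HardyBidisc) (σ : ℕ × ℕ → ℕ × ℕ),
      (∀ k, τ (HardyBidisc.monomialBasis k) = HardyBidisc.monomialBasis (σ k)) →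
      (∀ k i, T (modelShift A B k (b i)) = modelShift A B (σ k) (b i)) →
      ∀ x, T (Φ x) = Φ (tensorId τ L x) := by
    intro T τ σ hτ hT
    let Ψ : HilbertTensor HardyBidisc L →L[ℂ] H :=
      H₀.subtypeL ∘L (Φ : HilbertTensor HardyBidisc L →L[ℂ] H₀)
    have hΨ : ∀ p, Ψ (t p) = u p := hΦ
    have key : T ∘L Ψ = Ψ ∘L tensorId τ L := by
      refine ext_hilbertBasis t fun p => ?_
      have h1 : tensorId τ L (t p) = t (σ p.1, p.2) := by
        rw [tensorBasis_apply, tensorBasis_apply, tensorId_coe_tmul, hτ]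
      change T (Ψ (t p)) = Ψ (tensorId τ L (t p))
      rw [h1, hΨ, hΨ]
      exact hT _ _
    exact fun x => DFunLike.congr_fun key x
  have hstar : ∀ T : H →L[ℂ] H,
      (∀ k i, star T (modelShift A B k (b i)) = 0 ∨
        ∃ l, star T (modelShift A B k (b i)) = modelShift A B l (b i)) →
      Set.MapsTo T (H₀ᗮ : Submodule ℂ H) (H₀ᗮ : Submodule ℂ H) := by
    intro T hT
    refine mapsTo_orthogonal_closure_span fun p => (hT p.1 p.2).imp_right ?_
    rintro ⟨l, hl⟩
    exact ⟨(l, p.2), hl⟩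
  have h₁ := hstar A fun k i => (hb i).star_left_modelShift h k
  have h₂ := hstar B fun k i => (hb i).star_right_modelShift h k
  -- Invariance under the adjoints too makes the complement reducing, so its defect is the
  -- restriction of `C`.
  have h₁' := hstar (star A) fun k i =>
    Or.inr ⟨_, by rw [star_star]; exact (hb i).left_modelShift h k⟩
  have h₂' := hstar (star B) fun k i =>
    Or.inr ⟨_, by rw [star_star]; exact (hb i).right_modelShift h k⟩
  refine ⟨H₀, hcl, Φ, hint A _ _ HardyBidisc.tau1_monomial fun k i => (hb i).left_modelShift h k,
    hint B _ _ HardyBidisc.tau2_monomial fun k i => (hb i).right_modelShift h k, h₁, h₂, ?_⟩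
  ext y
  rw [coe_defect_restrict h₁ h₂ h₁' h₂']
  -- `L` sits in the model as the multiples of `z₂`, so `H₀ᗮ` is orthogonal to `ran C`, and the
  -- self-adjoint `C` vanishes there.
  have hLH : ∀ z : L, (z : H) ∈ H₀ := by
    refine forall_mem_of_hilbertBasis b L.subtypeL hcl fun i => ?_
    have : u ((0, 1), i) = b i := by simp [u, modelShift]
    change (b i : H) ∈ H₀
    rw [← this]
    exact Submodule.le_topologicalClosure _ (Submodule.subset_span ⟨((0, 1), i), rfl⟩)
  have h0 : defect A B y = 0 := by
    refine ext_inner_right ℂ fun z => ?_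
    rw [IsNegPair.inner_defect_left, inner_zero_left]
    exact Submodule.inner_left_of_mem_orthogonal (hLH ⟨_, z, rfl⟩) y.2
  rw [h0]
  rfl

end Decomposition

end NegDefect

end

theorem mainTheorem1 {H : Type*} [NormedAddCommGroup H] [InnerProductSpace ℂ H] [CompleteSpace H]
    (V₁ V₂ : H →L[ℂ] H) (hV₁ : Isometry V₁) (hV₂ : Isometry V₂) (hcomm : V₁ * V₂ = V₂ * V₁)
    (hneg : NegDefect.defect V₁ V₂ ≤ 0) (hne : NegDefect.defect V₁ V₂ ≠ 0) :
    (∃ L : Submodule ℂ H, IsClosed (L : Set H) ∧ L ≠ ⊥ ∧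
      L < LinearMap.ker (star (V₁ * V₂) : H →L[ℂ] H).toLinearMap ∧
      NegDefect.SameHilbertDim L (LinearMap.range (NegDefect.defect V₁ V₂).toLinearMap) ∧
      ∃ H₀ : Submodule ℂ H, IsClosed (H₀ : Set H) ∧
        ∃ Φ : NegDefect.HilbertTensor NegDefect.HardyBidisc L ≃ₗᵢ[ℂ] H₀,
          (∀ x, V₁ (Φ x) = Φ (NegDefect.tensorId NegDefect.HardyBidisc.tau1 L x)) ∧
          (∀ x, V₂ (Φ x) = Φ (NegDefect.tensorId NegDefect.HardyBidisc.tau2 L x)) ∧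
          ∃ (h₁ : Set.MapsTo V₁ H₀ᗮ H₀ᗮ) (h₂ : Set.MapsTo V₂ H₀ᗮ H₀ᗮ),
            NegDefect.defect (V₁.restrict h₁) (V₂.restrict h₂) = 0) ∧
    NegDefect.jointSpectrum V₁ V₂ = Metric.closedBall (0 : ℂ) 1 ×ˢ Metric.closedBall (0 : ℂ) 1 ∧
    ∀ l₁ l₂ : ℂ, ‖l₁‖ < 1 → ‖l₂‖ < 1 →
      ¬ NegDefect.KoszulExact2 (V₁ - l₁ • (1 : H →L[ℂ] H)) (V₂ - l₂ • (1 : H →L[ℂ] H)) := by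
  have h : NegDefect.IsNegPair V₁ V₂ :=
    ⟨(V₁.isometry_iff_adjoint_comp_self).1 hV₁, (V₂.isometry_iff_adjoint_comp_self).1 hV₂,
      hcomm, hneg⟩
  refine ⟨⟨LinearMap.range (NegDefect.defect V₁ V₂).toLinearMap, h.isClosed_range_defect, ?_,
    h.range_defect_lt_ker hne, ?_, h.exists_decomposition⟩, h.jointSpectrum_eq hne,
    fun _ _ => h.not_koszulExact2 hne⟩
  · rw [Ne, LinearMap.range_eq_bot]
    exact fun h0 => hne (ContinuousLinearMap.ext fun x => LinearMap.congr_fun h0 x)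
  · have : CompleteSpace (LinearMap.range (NegDefect.defect V₁ V₂).toLinearMap) :=
      h.isClosed_range_defect.completeSpace_coe
    obtain ⟨w, b, -⟩ := exists_hilbertBasis ℂ
      (LinearMap.range (NegDefect.defect V₁ V₂).toLinearMap)
    exact ⟨w, ⟨b⟩, ⟨b⟩⟩
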